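/- For $k\ge 1$ define graphs as follows. * The chain of boxes $B_k$ consists of a path $v_0,v_1,\dots,v_{2k-1}$ together with, for each $0\le i<k$, two new vertices $a_i,b_i$ and the path $v_{2i},a_i,b_i,v_{2i+1}$. * The gadget $H_k$ is obtained from the twelve-cycle with vertices, in cyclic order, $a,x_1,w_1,u,w_2,x_2,b,y_2,z_2,v,z_1,y_1$ by adding the edge $\{a,b\}$ and four disjoint copies of $B_k$, identifying the ends $(v_0,v_{2k-1})$ of the copies with $(w_1,a)$, $(a,z_1)$, $(w_2,b)$ and $(b,z_2)$ respectively. * The graph $G_k$ consists of four disjoint copies $H^1,\dots,H^4$ of $H_k$ and four further vertices $t_1,\dots,t_4$, where $t_i$ is joined to the vertex $u$ of $H^i$ and to the vertex $v$ of $H^{i-1}$ (indices modulo $4$). For a graph $G=(V,E)$ let $\Omega$ be the set of perfect matchings $\mathcal P$ and near-perfect matchings (those with exactly two unmatched vertices) of $G$. The hole pattern of $M\in\Omega$ is its set of unmatched vertices. The Broder chain on $\Omega$ moves from $M$ as follows. If $M$ is perfect, remove a uniformly random edge of $M$. If $M$ has holes $p,q$, choose a uniformly random $x\in V$. If $x\in\{p,q\}$,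 add the edge $\{p,q\}$ if it is an edge of $G$, and otherwise stay. If $x\notin\{p,q\}$, let $y$ be the partner of $x$ in $M$ and choose $h\in\{p,q\}$ uniformly at random; replace $\{x,y\}$ by $\{x,h\}$ if $x$ and $h$ are adjacent, and otherwise stay. A Markov chain on $\Omega$ is of JSV type if, for some weight function $w:\Omega\to(0,\infty)$ with $w(M)$ depending only on the hole pattern of $M$, it moves from $M$ by drawing a proposal $M'$ from the Broder chain and accepting it with probability $\min\{1,w(M')/w(M)\}$, staying at $M$ otherwise. The mixing time of a chain with transition matrix $P$ and stationary distribution $\pi$ is $T_{\mathrm{mix}}=\max_{i}\min\{t: \tfrac12\sum_{j}|P^t(i,j)-\pi(j)|\le \tfrac14\}$. **Theorem.** The graph $G_k$ has $n=64k+20$ vertices for every $k\ge1$, and there are constants $c>0$ and $K\ge 1$ such that for every $k\ge K$ the following holds. Every Markov chain of JSV type on $G_k$ has a unique stationary distribution $\pi$, and either $\pi(\mathcal P)\le \exp(-cn)$ or $T_{\mathrm{mix}}\ge\exp(cn)$. -/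

import Mathlib

open scoped ENNReal Matrix

noncomputable section

namespace JSV

/-! ### Finite Markov chains -/

section MarkovChain

variable {S : Type*} [Fintype S] [DecidableEq S]

/-- `π` is a stationary distribution of the chain with transition matrix `P`. -/
def IsStationary (P : Matrix S S ℝ) (π : S → ℝ) : Prop :=
  π ∈ stdSimplex ℝ S ∧ π ᵥ* P = π

/-- Total variation distance. -/
def dTV (μ ν : S → ℝ) : ℝ := (1 / 2) * ∑ x, |μ x - ν x|

/-- The mixing time: the maximum over the starting states `i` of the least `t` such that
`P ^ t (i, ·)` is within total variation distance `1 / 4` of `π` (`⊤` if there is no such `t`). -/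
def mixingTime (P : Matrix S S ℝ) (π : S → ℝ) : ℕ∞ :=
  ⨆ i : S, ⨅ t : {t : ℕ // dTV ((P ^ t) i) π ≤ 1 / 4}, ((t : ℕ) : ℕ∞)

end MarkovChain

/-! ### The Broder chain and chains of JSV type on a graph -/

section Chain

variable {V : Type*} [Fintype V] [DecidableEq V]

/-- A set `M` of edges of `G`, no two of which share a vertex. -/
def IsMatching (G : SimpleGraph V) (M : Finset (Sym2 V)) : Prop :=
  (∀ e ∈ M, e ∈ G.edgeSet) ∧ ∀ e ∈ M, ∀ f ∈ M, ∀ v, v ∈ e → v ∈ f → e = f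

/-- The holes (unmatched vertices) of `M`. -/
def holes (M : Finset (Sym2 V)) : Finset V :=
  Finset.univ.filter fun v => ∀ e ∈ M, v ∉ e

/-- The state space: perfect matchings (no hole) and near-perfect matchings (exactly two holes). -/
def State (G : SimpleGraph V) : Type _ :=
  {M : Finset (Sym2 V) // IsMatching G M ∧ ((holes M).card = 0 ∨ (holes M).card = 2)}

instance (G : SimpleGraph V) : DecidableEq (State G) :=
  inferInstanceAs (DecidableEq {M : Finset (Sym2 V) //
    IsMatching G M ∧ ((holes M).card = 0 ∨ (holes M).card = 2)})

open Classical in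
instance (G : SimpleGraph V) : Fintype (State G) :=
  inferInstanceAs (Fintype {M : Finset (Sym2 V) //
    IsMatching G M ∧ ((holes M).card = 0 ∨ (holes M).card = 2)})

/-- The set of perfect matchings. -/
def perfectMatchings (G : SimpleGraph V) : Finset (State G) :=
  Finset.univ.filter fun M => holes M.1 = ∅

open Classical in
/-- The move of the Broder chain from a near-perfect matching `M` when the vertex `x` and the hole
`w` have been chosen. If `x` is a hole, the edge joining the two holes is added, if there is one
(and nothing happens otherwise; `w` is then not used). If `x` is not a hole, the edge of `M` at `x`
is replaced by `{x, w}` provided `x` is adjacent to `w`; otherwise nothing happens. -/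
def nearMove (G : SimpleGraph V) (M : Finset (Sym2 V)) (x w : V) : Finset (Sym2 V) :=
  if x ∈ holes M then
    M ∪ Finset.univ.filter fun e => e ∈ G.edgeSet ∧ ∀ z ∈ e, z ∈ holes M
  else if G.Adj x w then
    insert s(x, w) (M.filter fun e => x ∉ e)
  else M

/-- Transition probabilities of the Broder chain. From a perfect matching `M` a uniformly random
edge of `M` is removed; from a near-perfect matching, `nearMove` is applied with a uniformly random
vertex `x` and an independent uniformly random hole `w`. -/
def broder (G : SimpleGraph V) (M M' : State G) : ℝ :=
  if holes M.1 = ∅ then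
    ((M.1.filter fun e => M'.1 = M.1.erase e).card : ℝ) / (M.1.card : ℝ)
  else
    (((Finset.univ ×ˢ holes M.1).filter fun p : V × V => M'.1 = nearMove G M.1 p.1 p.2).card : ℝ) /
      ((Fintype.card V : ℝ) * ((holes M.1).card : ℝ))

/-- The Broder chain with a Metropolis filter for the weight function `w`: a proposal `M'` from `M`
is accepted with probability `min 1 (w M' / w M)`, and otherwise the chain stays at `M`. -/
def metropolis (G : SimpleGraph V) (w : State G → ℝ) : Matrix (State G) (State G) ℝ :=
  fun M M' => broder G M M' * min 1 (w M' / w M) +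
    if M = M' then ∑ N : State G, broder G M N * (1 - min 1 (w N / w M)) else 0

/-- `P` is the transition matrix of a chain of JSV type: the Broder chain with a Metropolis filter
for some (positive) weight function depending only on the hole pattern. -/
def IsJSVType (G : SimpleGraph V) (P : Matrix (State G) (State G) ℝ) : Prop :=
  ∃ w : State G → ℝ, (∀ M, 0 < w M) ∧ (∀ M M', holes M.1 = holes M'.1 → w M = w M') ∧
    P = metropolis G w

end Chain

/-! ### The graphs -/

/-- Vertices of the chain of boxes of length `k`: a path `v 0, …, v (2k-1)` and, for each `i < k`,
two additional vertices `a i`, `b i`. -/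
inductive BoxVertex (k : ℕ)
  | v (i : Fin (2 * k))
  | a (i : Fin k)
  | b (i : Fin k)
  deriving DecidableEq, Fintype

/-- The chain of boxes: the path `v 0, …, v (2k-1)` and the paths
`v (2i), a i, b i, v (2i+1)` for `i < k`. -/
def boxChain (k : ℕ) : SimpleGraph (BoxVertex k) :=
  SimpleGraph.fromRel fun p q => match p, q with
    | .v i, .v j => (i : ℕ) + 1 = j
    | .v i, .a j => (i : ℕ) = 2 * j
    | .a i, .b j => i = j
    | .b i, .v j => (j : ℕ) = 2 * i + 1
    | _, _ => False

/-- Whether a vertex is an end `v 0` or `v (2k-1)` of the chain of boxes. -/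
def BoxVertex.IsEnd {k : ℕ} : BoxVertex k → Prop
  | .v i => (i : ℕ) = 0 ∨ (i : ℕ) + 1 = 2 * k
  | _ => False

instance {k : ℕ} : DecidablePred (BoxVertex.IsEnd (k := k)) := fun p =>
  match p with
  | .v i => inferInstanceAs (Decidable ((i : ℕ) = 0 ∨ (i : ℕ) + 1 = 2 * k))
  | .a _ => inferInstanceAs (Decidable False)
  | .b _ => inferInstanceAs (Decidable False)

/-- Vertices of the torpid mixing gadget: the vertices of a twelve-cycle, in cyclic order
`a, x₁, w₁, u, w₂, x₂, b, y₂, z₂, v, z₁, y₁` (numbered from `0` to `11`), and the vertices other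
than the two ends of four chains of boxes. -/
inductive GadgetVertex (k : ℕ)
  | cyc (i : Fin 12)
  | inner (j : Fin 4) (p : {p : BoxVertex k // ¬ p.IsEnd})
  deriving DecidableEq, Fintype

/-- The position on the twelve-cycle with which `v 0` of the `j`-th chain of boxes is identified:
`w₁`, `a`, `w₂`, `b`. -/
def chainStart : Fin 4 → Fin 12 := ![2, 0, 4, 6]

/-- The position on the twelve-cycle with which `v (2k-1)` of the `j`-th chain of boxes is
identified: `a`, `z₁`, `b`, `z₂`. -/
def chainEnd : Fin 4 → Fin 12 := ![0, 10, 6, 8]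

/-- The vertex of the gadget that the vertex `p` of the `j`-th chain of boxes becomes. -/
def chainMap (k : ℕ) (j : Fin 4) (p : BoxVertex k) : GadgetVertex k :=
  if h : p.IsEnd then
    .cyc (if ∃ i : Fin (2 * k), p = .v i ∧ (i : ℕ) = 0 then chainStart j else chainEnd j)
  else .inner j ⟨p, h⟩

/-- The torpid mixing gadget: a twelve-cycle, the chord `{a, b}`, and four chains of boxes
joining `w₁` to `a`, `a` to `z₁`, `w₂` to `b` and `b` to `z₂`. -/
def gadget (k : ℕ) : SimpleGraph (GadgetVertex k) :=
  SimpleGraph.fromRel fun p q =>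
    (∃ i j : Fin 12, (SimpleGraph.cycleGraph 12).Adj i j ∧ p = .cyc i ∧ q = .cyc j) ∨
    (p = .cyc 0 ∧ q = .cyc 6) ∨
    (∃ (j : Fin 4) (r s : BoxVertex k), (boxChain k).Adj r s ∧
      p = chainMap k j r ∧ q = chainMap k j s)

/-- Vertices of the counterexample graph: `t 0, …, t 3` and four copies of the gadget. -/
inductive GVertex (k : ℕ)
  | t (i : Fin 4)
  | copy (i : Fin 4) (p : GadgetVertex k)
  deriving DecidableEq, Fintype

/-- The counterexample graph: four copies of the gadget and the vertices `t i` arranged in a circle;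
with `u i`, `v i` the vertices `u`, `v` of the `i`-th copy, `t i` is adjacent to `u i` and to
`v (i - 1)` (indices modulo `4`). -/
def counterexampleGraph (k : ℕ) : SimpleGraph (GVertex k) :=
  SimpleGraph.fromRel fun p q => match p, q with
    | .copy i r, .copy j s => i = j ∧ (gadget k).Adj r s
    | .t i, .copy j r => (r = .cyc 3 ∧ j = i) ∨ (r = .cyc 9 ∧ j = i - 1)
    | _, _ => False

end JSV

end

set_option linter.unusedSectionVars false

open scoped ENNReal Matrix

noncomputable section

namespace JSV

/-! ### Reversible chains: uniqueness of the stationary distribution, bottleneck bound -/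

section ReversibleChains

variable {S : Type*} [Fintype S] [DecidableEq S]

/-! A bottleneck separates two classes of perfect matchings. A gadget has an even number of vertices
and meets the rest of the graph only through `u` and `v`, so in a hole-free copy `u` is matched
outwards iff `v` is (`exit_u_iff_exit_v`). Each `t i` is matched to exactly one of its two
neighbours, so in a perfect matching the copies alternate around the circle between "both out" and
"both in". This leaves two classes, exchanged by rotating the circle by one step and hence equally
large (`card_perfect_side`).

`Flag` extends "both out" to copies with holes, and `side` consists of the states for which at least
three of the four flags agree with the first class. If a copy has at most one hole before and after
a move, its flag can change only when a rare configuration occurs at one end of the move: a hole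
leaving `u` or `v` into the gadget must land on `mid c`, because a chain of boxes without inner
holes is entered at both ends or at neither (`rare_of_slide`, `flag_slide`). If a copy contains two
holes, the other three are hole-free and alternation is forced, so the number of agreeing flags is 4
or 0; only that one flag is uncontrolled during the move, so the count cannot cross the threshold 3.
Thus every move across the cut starts or ends in a rare state (`no_crossing`).

Rare states have small weight for every weight function depending only on hole patterns. In a rare
configuration the matching near the chain `c` is completely forced: the chord is used and the
chain's inner vertices are matched in the unique way `off` (`rarePart_subset`). The same vertices
can be rematched so that both chain ends are matched inside the chain, where each of the `k` boxes
has two perfect matchings. These `2 ^ k` exchanges keep the holes and are jointly injective, so a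
rare set carries at most a `2 ^ (-k)` fraction of the total weight (`two_pow_mul_sum_rare_le`).

The Broder chain is symmetric, so the Metropolis chain is reversible with respect to the normalised
weight. The conductance argument (`bottleneck`, `flow_le`) then bounds the mixing time below by
`π(perfect) * 2 ^ k / 128` (`perfect_le_mixing`): either the perfect matchings are exponentially
unlikely or mixing takes exponential time. -/

/-- A probability vector satisfying detailed balance is stationary, and it is the only stationary
distribution if it is positive and the chain is irreducible. -/
theorem isStationary_and_unique_of_reversible {P : Matrix S S ℝ} {π : S → ℝ}
    (hpos : ∀ i, 0 < π i) (hsum : ∑ i, π i = 1) (hnn : ∀ i j, 0 ≤ P i j)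
    (hrow : ∀ i, ∑ j, P i j = 1) (hrev : ∀ i j, π i * P i j = π j * P j i)
    (hirr : ∀ i j, Relation.ReflTransGen (fun i j => 0 < P i j) i j) :
    IsStationary P π ∧ ∀ π', IsStationary P π' → π' = π := by
  refine ⟨⟨⟨fun i => (hpos i).le, hsum⟩, ?_⟩, ?_⟩
  · funext j
    simp only [Matrix.vecMul, dotProduct]
    calc ∑ i, π i * P i j = ∑ i, π j * P j i := Finset.sum_congr rfl fun i _ => hrev i j
      _ = π j := by rw [← Finset.mul_sum, hrow, mul_one]
  · rintro π' ⟨⟨_, hsum'⟩, hst⟩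
    -- By reversibility the density `h` of `π'` with respect to `π` is harmonic, and the maximum
    -- principle along positive transitions makes it constant. Aperiodicity plays no role.
    set h : S → ℝ := fun i => π' i / π i with hh
    have hπ' : ∀ i, π' i = h i * π i := fun i => by
      simp only [hh]; field_simp [(hpos i).ne']
    have hharm : ∀ j, ∑ i, P j i * h i = h j := by
      intro j
      have h1 : ∑ i, π' i * P i j = π' j := congrFun hst j
      have h2 : ∑ i, π' i * P i j = π j * ∑ i, P j i * h i := by
        rw [Finset.mul_sum]
        refine Finset.sum_congr rfl fun i _ => ?_
        rw [hπ' i, mul_assoc, hrev i j]; ring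
      rw [h2, hπ' j, mul_comm (h j)] at h1
      exact mul_left_cancel₀ (hpos j).ne' h1
    have hne : (Finset.univ : Finset S).Nonempty := by
      by_contra hcon
      rw [Finset.not_nonempty_iff_eq_empty] at hcon
      rw [hcon] at hsum; simp at hsum
    obtain ⟨m, -, hm⟩ := Finset.exists_max_image Finset.univ h hne
    have hconst : ∀ j, h j = h m := by
      intro j
      induction hirr m j with
      | refl => rfl
      | @tail a b _ hab ih =>
        by_contra hb
        have hlt : h b < h m := lt_of_le_of_ne (hm b (Finset.mem_univ _)) hb
        have : ∑ i, P a i * h i < ∑ i, P a i * h m :=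
          Finset.sum_lt_sum
            (fun i _ => mul_le_mul_of_nonneg_left (hm i (Finset.mem_univ _)) (hnn a i))
            ⟨b, Finset.mem_univ _, mul_lt_mul_of_pos_left hlt hab⟩
        rw [hharm, ← Finset.sum_mul, hrow, one_mul, ih] at this
        exact lt_irrefl _ this
    have hm1 : h m = 1 := by
      have : ∑ i, π' i = h m := by
        rw [Finset.sum_congr rfl fun i _ => (hπ' i).trans (by rw [hconst i]),
          ← Finset.mul_sum, hsum, mul_one]
      rw [← this, hsum']
    funext i
    rw [hπ' i, hconst i, hm1, one_mul]

theorem dTV_vecMul_le {P : Matrix S S ℝ} {π : S → ℝ} (hnn : ∀ i j, 0 ≤ P i j)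
    (hrow : ∀ i, ∑ j, P i j = 1) (hst : π ᵥ* P = π) (μ : S → ℝ) :
    dTV (μ ᵥ* P) π ≤ dTV μ π := by
  unfold dTV
  refine mul_le_mul_of_nonneg_left ?_ (by norm_num)
  calc ∑ j, |(μ ᵥ* P) j - π j| = ∑ j, |∑ i, (μ i - π i) * P i j| := by
        refine Finset.sum_congr rfl fun j _ => ?_
        conv_lhs => rw [← congrFun hst j]
        simp only [Matrix.vecMul, dotProduct, sub_mul, Finset.sum_sub_distrib]
    _ ≤ ∑ j, ∑ i, |μ i - π i| * P i j := by
        refine Finset.sum_le_sum fun j _ => (Finset.abs_sum_le_sum_abs _ _).trans ?_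
        refine Finset.sum_le_sum fun i _ => ?_
        rw [abs_mul, abs_of_nonneg (hnn i j)]
    _ = ∑ i, |μ i - π i| := by
        rw [Finset.sum_comm]
        refine Finset.sum_congr rfl fun i _ => ?_
        rw [← Finset.mul_sum, hrow, mul_one]

theorem dTV_pow_antitone {P : Matrix S S ℝ} {π : S → ℝ} (hnn : ∀ i j, 0 ≤ P i j)
    (hrow : ∀ i, ∑ j, P i j = 1) (hst : π ᵥ* P = π) (i : S) :
    Antitone fun t : ℕ => dTV ((P ^ t) i) π := by
  refine antitone_nat_of_succ_le fun t => ?_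
  have : (P ^ (t + 1)) i = ((P ^ t) i) ᵥ* P := by
    rw [pow_succ]; rfl
  simp only [this]
  exact dTV_vecMul_le hnn hrow hst _

/-- The mixing time records only the first time at which the distance is small; since the distance
to `π` never increases, the bound persists at all later times. -/
theorem dTV_le_of_mixingTime_le {P : Matrix S S ℝ} {π : S → ℝ} (hnn : ∀ i j, 0 ≤ P i j)
    (hrow : ∀ i, ∑ j, P i j = 1) (hst : π ᵥ* P = π) {t : ℕ} (ht : mixingTime P π ≤ t) (i : S) :
    dTV ((P ^ t) i) π ≤ 1 / 4 := by
  have hi : (⨅ s : {s : ℕ // dTV ((P ^ s) i) π ≤ 1 / 4}, ((s : ℕ) : ℕ∞)) ≤ t :=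
    (le_iSup (fun i : S => ⨅ s : {s : ℕ // dTV ((P ^ s) i) π ≤ 1 / 4}, ((s : ℕ) : ℕ∞)) i).trans ht
  by_contra hcon
  have : ((t + 1 : ℕ) : ℕ∞) ≤ ⨅ s : {s : ℕ // dTV ((P ^ s) i) π ≤ 1 / 4}, ((s : ℕ) : ℕ∞) := by
    refine le_iInf fun s => ?_
    have hs : t < s.1 := by
      by_contra hle
      exact hcon ((dTV_pow_antitone hnn hrow hst i (not_lt.mp hle)).trans s.2)
    exact_mod_cast hs
  have h2 := this.trans hi
  norm_cast at h2
  omega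

/-- With equal total masses the deficit of `μ` on `T` equals its excess on the complement, so it is
counted twice in the `ℓ¹` distance. -/
theorem sum_sub_sum_le_dTV (μ ν : S → ℝ) (h : ∑ i, μ i = ∑ i, ν i) (T : Finset S) :
    ∑ i ∈ T, ν i - ∑ i ∈ T, μ i ≤ dTV μ ν := by
  have h1 : ∑ i ∈ T, ν i - ∑ i ∈ T, μ i = ∑ i ∈ Tᶜ, μ i - ∑ i ∈ Tᶜ, ν i := by
    have := Finset.sum_add_sum_compl T μ
    have := Finset.sum_add_sum_compl T ν
    linarith
  have h2 : ∑ i ∈ T, ν i - ∑ i ∈ T, μ i ≤ ∑ i ∈ T, |μ i - ν i| := by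
    rw [← Finset.sum_sub_distrib]
    exact Finset.sum_le_sum fun i _ => by rw [abs_sub_comm]; exact le_abs_self _
  have h3 : ∑ i ∈ Tᶜ, μ i - ∑ i ∈ Tᶜ, ν i ≤ ∑ i ∈ Tᶜ, |μ i - ν i| := by
    rw [← Finset.sum_sub_distrib]
    exact Finset.sum_le_sum fun i _ => le_abs_self _
  have h4 := Finset.sum_add_sum_compl T fun i => |μ i - ν i|
  unfold dTV
  linarith

theorem pow_apply_nonneg {P : Matrix S S ℝ} (hnn : ∀ i j, 0 ≤ P i j) (t : ℕ) (i j : S) :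
    0 ≤ (P ^ t) i j := by
  induction t generalizing i j with
  | zero => rw [pow_zero, Matrix.one_apply]; split_ifs <;> norm_num
  | succ t ih =>
    rw [pow_succ, Matrix.mul_apply]
    exact Finset.sum_nonneg fun k _ => mul_nonneg (ih i k) (hnn k j)

theorem pow_row_sum {P : Matrix S S ℝ} (hrow : ∀ i, ∑ j, P i j = 1) (t : ℕ) (i : S) :
    ∑ j, (P ^ t) i j = 1 := by
  induction t with
  | zero => simp [Matrix.one_apply]
  | succ t ih =>
    simp only [pow_succ, Matrix.mul_apply]
    rw [Finset.sum_comm]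
    simp only [← Finset.mul_sum, hrow, mul_one, ih]

theorem pow_stationary {P : Matrix S S ℝ} {π : S → ℝ} (hst : π ᵥ* P = π) (t : ℕ) :
    π ᵥ* (P ^ t) = π := by
  induction t with
  | zero => simp
  | succ t ih => rw [pow_succ, ← Matrix.vecMul_vecMul, ih, hst]

/-- The stationary chain started in `T` is outside `T` at time `t` with probability at most `t`
times the flow out of `T`. -/
theorem escape_le {P : Matrix S S ℝ} {π : S → ℝ} (hπ : ∀ i, 0 ≤ π i) (hnn : ∀ i j, 0 ≤ P i j)
    (hrow : ∀ i, ∑ j, P i j = 1) (hst : π ᵥ* P = π) (T : Finset S) (t : ℕ) :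
    ∑ i ∈ T, ∑ j ∈ Tᶜ, π i * (P ^ t) i j ≤ t * ∑ i ∈ T, ∑ j ∈ Tᶜ, π i * P i j := by
  induction t with
  | zero =>
    simp only [pow_zero, Nat.cast_zero, zero_mul]
    refine Finset.sum_nonpos fun i hi => Finset.sum_nonpos fun j hj => ?_
    rw [Matrix.one_apply_ne (by rintro rfl; simp_all), mul_zero]
  | succ t ih =>
    -- Condition on the position `l` at time `t`. For `l ∈ T`, stationarity bounds the incoming mass
    -- by `π l`, giving one more unit of flow; for `l ∉ T`, the mass had already escaped.
    have key : ∑ i ∈ T, ∑ j ∈ Tᶜ, π i * (P ^ (t + 1)) i j =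
        ∑ l, (∑ i ∈ T, π i * (P ^ t) i l) * ∑ j ∈ Tᶜ, P l j := by
      simp only [pow_succ, Matrix.mul_apply, Finset.mul_sum, Finset.sum_mul]
      rw [Finset.sum_comm]
      rw [Finset.sum_congr rfl fun j _ => Finset.sum_comm]
      rw [Finset.sum_comm]
      refine Finset.sum_congr rfl fun l _ => Finset.sum_congr rfl fun j _ =>
        Finset.sum_congr rfl fun i _ => by ring
    rw [key, ← Finset.sum_add_sum_compl T]
    have h1 : ∑ l ∈ T, (∑ i ∈ T, π i * (P ^ t) i l) * ∑ j ∈ Tᶜ, P l j ≤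
        ∑ i ∈ T, ∑ j ∈ Tᶜ, π i * P i j := by
      refine Finset.sum_le_sum fun l _ => ?_
      rw [← Finset.mul_sum]
      refine mul_le_mul_of_nonneg_right ?_ (Finset.sum_nonneg fun j _ => hnn l j)
      calc ∑ i ∈ T, π i * (P ^ t) i l ≤ ∑ i, π i * (P ^ t) i l :=
            Finset.sum_le_sum_of_subset_of_nonneg (Finset.subset_univ _)
              fun i _ _ => mul_nonneg (hπ i) (pow_apply_nonneg hnn t i l)
        _ = π l := congrFun (pow_stationary hst t) l
    have h2 : ∑ l ∈ Tᶜ, (∑ i ∈ T, π i * (P ^ t) i l) * ∑ j ∈ Tᶜ, P l j ≤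
        ∑ i ∈ T, ∑ j ∈ Tᶜ, π i * (P ^ t) i j := by
      rw [Finset.sum_comm]
      refine Finset.sum_le_sum fun l _ => ?_
      refine mul_le_of_le_one_right
        (Finset.sum_nonneg fun i _ => mul_nonneg (hπ i) (pow_apply_nonneg hnn t i l)) ?_
      rw [← hrow l]
      exact Finset.sum_le_sum_of_subset_of_nonneg (Finset.subset_univ _) fun j _ _ => hnn l j
    push_cast
    linarith

/-- A set of probability at most `1 / 2` with small flow out of it forces a large mixing time. -/
theorem bottleneck {P : Matrix S S ℝ} {π : S → ℝ} (hst : IsStationary P π)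
    (hnn : ∀ i j, 0 ≤ P i j) (hrow : ∀ i, ∑ j, P i j = 1) (T : Finset S)
    (hT : 1 / 2 ≤ ∑ i ∈ Tᶜ, π i) {t : ℕ} (ht : mixingTime P π ≤ t) :
    (∑ i ∈ T, π i) * (1 / 4) ≤ t * ∑ i ∈ T, ∑ j ∈ Tᶜ, π i * P i j := by
  refine le_trans ?_ (escape_le hst.1.1 hnn hrow hst.2 T t)
  rw [Finset.sum_mul]
  refine Finset.sum_le_sum fun i _ => ?_
  rw [← Finset.mul_sum]
  refine mul_le_mul_of_nonneg_left ?_ (hst.1.1 i)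
  -- From every start `i`, the chance of being outside `T` at time `t` is at least `1 / 2 - 1 / 4`.
  have h1 := sum_sub_sum_le_dTV ((P ^ t) i) π
    ((pow_row_sum hrow t i).trans hst.1.2.symm) Tᶜ
  have h2 := dTV_le_of_mixingTime_le hnn hrow hst.2 ht i
  linarith

end ReversibleChains

/-! ### Matchings and the moves of the Broder chain -/

section Matchings

variable {V : Type*} [Fintype V] [DecidableEq V] {G : SimpleGraph V} {M N : Finset (Sym2 V)}

theorem mem_holes {v : V} : v ∈ holes M ↔ ∀ e ∈ M, v ∉ e := by simp [holes]

theorem not_mem_holes {v : V} : v ∉ holes M ↔ ∃ y, s(v, y) ∈ M := by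
  rw [mem_holes]
  push Not
  constructor
  · rintro ⟨e, he, y, rfl⟩
    exact ⟨y, he⟩
  · rintro ⟨y, hy⟩
    exact ⟨_, hy, Sym2.mem_mk_left _ _⟩

theorem not_mem_holes_left {x y : V} (h : s(x, y) ∈ M) : x ∉ holes M := not_mem_holes.2 ⟨y, h⟩

theorem not_mem_holes_right {x y : V} (h : s(x, y) ∈ M) : y ∉ holes M :=
  not_mem_holes.2 ⟨x, Sym2.eq_swap ▸ h⟩

theorem IsMatching.adj (hM : IsMatching G M) {x y : V} (h : s(x, y) ∈ M) : G.Adj x y := hM.1 _ h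

theorem IsMatching.right_unique (hM : IsMatching G M) {x y z : V} (h : s(x, y) ∈ M)
    (h' : s(x, z) ∈ M) : y = z :=
  Sym2.congr_right.1 (hM.2 _ h _ h' x (Sym2.mem_mk_left _ _) (Sym2.mem_mk_left _ _))

theorem IsMatching.filter_not_mem (hM : IsMatching G M) {x y : V} (h : s(x, y) ∈ M) :
    M.filter (fun e => x ∉ e) = M.erase s(x, y) := by
  ext e
  simp only [Finset.mem_filter, Finset.mem_erase]
  constructor
  · rintro ⟨he, hx⟩
    exact ⟨fun h' => hx (h' ▸ Sym2.mem_mk_left _ _), he⟩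
  · rintro ⟨hne, he⟩
    exact ⟨he, fun hx => hne (hM.2 _ he _ h x hx (Sym2.mem_mk_left _ _))⟩

theorem IsMatching.subset (hM : IsMatching G M) (h : N ⊆ M) : IsMatching G N :=
  ⟨fun e he => hM.1 e (h he), fun e he f hf => hM.2 e (h he) f (h hf)⟩

theorem IsMatching.insert_edge (hM : IsMatching G M) {p q : V} (hp : p ∈ holes M) (hq : q ∈ holes M)
    (h : G.Adj p q) : IsMatching G (insert s(p, q) M) := by
  have key : ∀ e ∈ M, ∀ v, v ∈ s(p, q) → v ∉ e := by
    intro e he v hv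
    rcases Sym2.mem_iff.1 hv with rfl | rfl
    exacts [mem_holes.1 hp e he, mem_holes.1 hq e he]
  constructor
  · intro e he
    rcases Finset.mem_insert.1 he with rfl | he
    exacts [h, hM.1 e he]
  · intro e he f hf v hve hvf
    rcases Finset.mem_insert.1 he with rfl | he <;> rcases Finset.mem_insert.1 hf with rfl | hf
    exacts [rfl, absurd hvf (key f hf v hve), absurd hve (key e he v hvf), hM.2 e he f hf v hve hvf]

theorem holes_insert (p q : V) : holes (insert s(p, q) M) = holes M \ {p, q} := by
  ext v
  simp only [mem_holes, Finset.mem_sdiff, Finset.mem_insert, Finset.mem_singleton,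
    forall_eq_or_imp, Sym2.mem_iff]
  tauto

theorem IsMatching.holes_erase (hM : IsMatching G M) {p q : V} (h : s(p, q) ∈ M) :
    holes (M.erase s(p, q)) = insert p (insert q (holes M)) := by
  ext v
  simp only [mem_holes, Finset.mem_erase, Finset.mem_insert]
  constructor
  · intro hv
    by_cases hpq : v ∈ s(p, q)
    · rcases Sym2.mem_iff.1 hpq with rfl | rfl <;> simp
    · refine Or.inr (Or.inr fun e he hve => ?_)
      by_cases hee : e = s(p, q)
      · exact hpq (hee ▸ hve)
      · exact hv e ⟨hee, he⟩ hve
  · rintro (rfl | rfl | hv) e ⟨hne, he⟩ hve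
    · exact hne (hM.2 _ he _ h v hve (Sym2.mem_mk_left _ _))
    · exact hne (hM.2 _ he _ h v hve (Sym2.mem_mk_right _ _))
    · exact hv e he hve

/-- `M'` arises from `M` by adding an edge between two holes. -/
def AddStep (G : SimpleGraph V) (M M' : Finset (Sym2 V)) : Prop :=
  ∃ p q, p ∈ holes M ∧ q ∈ holes M ∧ G.Adj p q ∧ M' = insert s(p, q) M

/-- `M'` arises from `M` by replacing an edge `{x, y}` by `{x, p}`, where `p` is a hole. -/
def SlideStep (G : SimpleGraph V) (M M' : Finset (Sym2 V)) : Prop :=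
  ∃ x y p, s(x, y) ∈ M ∧ p ∈ holes M ∧ G.Adj x p ∧ M' = insert s(x, p) (M.erase s(x, y))

section Slide

variable {x y p : V}

theorem IsMatching.slide (hM : IsMatching G M) (hxy : s(x, y) ∈ M) (hp : p ∈ holes M)
    (h : G.Adj x p) : IsMatching G (insert s(x, p) (M.erase s(x, y))) := by
  refine (hM.subset (Finset.erase_subset _ _)).insert_edge ?_ ?_ h
  · rw [hM.holes_erase hxy]; simp
  · rw [hM.holes_erase hxy]; simp [hp]

theorem IsMatching.holes_slide (hM : IsMatching G M) (hxy : s(x, y) ∈ M) (hp : p ∈ holes M) :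
    holes (insert s(x, p) (M.erase s(x, y))) = insert y ((holes M).erase p) := by
  have hx := not_mem_holes_left hxy
  have hy := not_mem_holes_right hxy
  have hne : x ≠ y := (hM.adj hxy).ne
  have hyp : y ≠ p := fun h => hy (h ▸ hp)
  rw [holes_insert, hM.holes_erase hxy]
  ext v
  simp only [Finset.mem_sdiff, Finset.mem_insert, Finset.mem_singleton, Finset.mem_erase]
  constructor
  · tauto
  · rintro (rfl | ⟨h1, h2⟩)
    · exact ⟨by simp, by simp [hne.symm, hyp]⟩
    · refine ⟨by simp [h2], ?_⟩
      rintro (rfl | rfl)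
      exacts [hx h2, h1 rfl]

theorem IsMatching.card_holes_slide (hM : IsMatching G M) (hxy : s(x, y) ∈ M) (hp : p ∈ holes M) :
    (holes (insert s(x, p) (M.erase s(x, y)))).card = (holes M).card := by
  rw [hM.holes_slide hxy hp, Finset.card_insert_of_notMem, Finset.card_erase_add_one hp]
  exact fun h => not_mem_holes_right hxy (Finset.mem_of_mem_erase h)

/-- The inverse of a slide is the slide with `y` and `p` exchanged: afterwards `y` is a hole and `p`
is the partner of `x`. -/
theorem slide_slide (hxy : s(x, y) ∈ M) (hp : p ∈ holes M) :
    M = insert s(x, y) ((insert s(x, p) (M.erase s(x, y))).erase s(x, p)) := by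
  rw [Finset.erase_insert, Finset.insert_erase hxy]
  exact fun h => mem_holes.1 hp _ (Finset.mem_of_mem_erase h) (Sym2.mem_mk_right _ _)

end Slide

theorem SlideStep.symm {M' : Finset (Sym2 V)} (hM : IsMatching G M) (h : SlideStep G M M') :
    SlideStep G M' M := by
  obtain ⟨x, y, p, hxy, hp, hadj, rfl⟩ := h
  refine ⟨x, p, y, Finset.mem_insert_self _ _, ?_, hM.adj hxy, slide_slide hxy hp⟩
  rw [hM.holes_slide hxy hp]
  exact Finset.mem_insert_self _ _

/-- A perfect matching has half as many edges as there are vertices. -/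
theorem IsMatching.two_mul_card (hM : IsMatching G M) (h : holes M = ∅) :
    2 * M.card = Fintype.card V := by
  have := Finset.sum_card_bipartiteAbove_eq_sum_card_bipartiteBelow
    (s := M) (t := (Finset.univ : Finset V)) (fun e v => v ∈ e)
  have h1 : ∀ e ∈ M, (Finset.bipartiteAbove (fun e v => v ∈ e) Finset.univ e).card = 2 := by
    intro e he
    induction e with
    | _ x y =>
      have : Finset.bipartiteAbove (fun (e : Sym2 V) v => v ∈ e) Finset.univ s(x, y) = {x, y} := by
        ext v; simp [Finset.mem_bipartiteAbove]
      rw [this, Finset.card_pair (hM.adj he).ne]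
  have h2 : ∀ v ∈ (Finset.univ : Finset V),
      (Finset.bipartiteBelow (fun (e : Sym2 V) v => v ∈ e) M v).card = 1 := by
    intro v _
    obtain ⟨y, hy⟩ := not_mem_holes.1 (h ▸ Finset.notMem_empty v : v ∉ holes M)
    rw [Finset.card_eq_one]
    refine ⟨s(v, y), ?_⟩
    ext e
    simp only [Finset.mem_bipartiteBelow, Finset.mem_singleton]
    constructor
    · rintro ⟨he, hv⟩
      exact hM.2 _ he _ hy v hv (Sym2.mem_mk_left _ _)
    · rintro rfl
      exact ⟨hy, Sym2.mem_mk_left _ _⟩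
  rw [Finset.sum_congr rfl h1, Finset.sum_congr rfl h2] at this
  simp only [Finset.sum_const, smul_eq_mul, Finset.card_univ, mul_one] at this
  omega

theorem nearMove_of_mem_adj {p q x w : V} (h : holes M = {p, q}) (hpq : G.Adj p q)
    (hx : x ∈ holes M) : nearMove G M x w = insert s(p, q) M := by
  rw [nearMove, if_pos hx, Finset.insert_eq, Finset.union_comm]
  congr 1
  ext e
  induction e with
  | _ a b =>
    simp only [Finset.mem_filter, Finset.mem_univ, true_and, h, Finset.mem_insert,
      Finset.mem_singleton, Sym2.mem_iff, SimpleGraph.mem_edgeSet, Sym2.eq_iff, forall_eq_or_imp,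
      forall_eq]
    constructor
    · rintro ⟨hab, rfl | rfl, rfl | rfl⟩
      · exact absurd rfl hab.ne
      · simp
      · simp
      · exact absurd rfl hab.ne
    · rintro (⟨rfl, rfl⟩ | ⟨rfl, rfl⟩)
      · simp [hpq]
      · simp [hpq.symm]

theorem nearMove_of_mem_not_adj {p q x w : V} (h : holes M = {p, q}) (hpq : ¬ G.Adj p q)
    (hx : x ∈ holes M) : nearMove G M x w = M := by
  rw [nearMove, if_pos hx]
  refine Finset.union_eq_left.2 fun e he => ?_
  induction e with
  | _ a b =>
    simp only [Finset.mem_filter, Finset.mem_univ, true_and, h, Finset.mem_insert,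
      Finset.mem_singleton, Sym2.mem_iff, SimpleGraph.mem_edgeSet, forall_eq_or_imp,
      forall_eq] at he
    obtain ⟨hab, rfl | rfl, rfl | rfl⟩ := he
    exacts [absurd rfl hab.ne, absurd hab hpq, absurd hab.symm hpq, absurd rfl hab.ne]

theorem IsMatching.nearMove_slide (hM : IsMatching G M) {x y w : V} (hxy : s(x, y) ∈ M)
    (hw : G.Adj x w) : nearMove G M x w = insert s(x, w) (M.erase s(x, y)) := by
  rw [nearMove, if_neg (not_mem_holes_left hxy), if_pos hw, ← hM.filter_not_mem hxy]

/-- The possible results of a move from a near-perfect matching. -/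
theorem IsMatching.nearMove_cases (hM : IsMatching G M) (hc : (holes M).card = 2) (x w : V) :
    nearMove G M x w = M ∨
      (x ∈ holes M ∧ AddStep G M (nearMove G M x w) ∧ holes (nearMove G M x w) = ∅) ∨
      ∃ y, s(x, y) ∈ M ∧ G.Adj x w ∧
        nearMove G M x w = insert s(x, w) (M.erase s(x, y)) := by
  by_cases hx : x ∈ holes M
  · obtain ⟨p, q, -, h⟩ := Finset.card_eq_two.1 hc
    by_cases hpq : G.Adj p q
    · have h1 := nearMove_of_mem_adj (w := w) h hpq hx
      refine Or.inr (Or.inl ⟨hx, ?_, ?_⟩)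
      · rw [h1]
        exact ⟨p, q, by simp [h], by simp [h], hpq, rfl⟩
      · rw [h1, holes_insert, h, Finset.sdiff_self]
    · exact Or.inl (nearMove_of_mem_not_adj h hpq hx)
  · by_cases hxw : G.Adj x w
    · obtain ⟨y, hy⟩ := not_mem_holes.1 hx
      exact Or.inr (Or.inr ⟨y, hy, hxw, hM.nearMove_slide hy hxw⟩)
    · exact Or.inl (by rw [nearMove, if_neg hx, if_neg hxw])

end Matchings

/-! ### Stochasticity, symmetry and irreducibility of the Broder chain -/

section Broder

variable {V : Type*} [Fintype V] [DecidableEq V] {G : SimpleGraph V}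

theorem State.ext {M N : State G} (h : M.1 = N.1) : M = N := Subtype.ext h

theorem State.card_holes_of_ne {M : State G} (h : holes M.1 ≠ ∅) : (holes M.1).card = 2 :=
  M.2.2.resolve_left fun h' => h (Finset.card_eq_zero.1 h')

/-- The near-perfect matching obtained by removing an edge from a perfect matching. -/
def State.erase (M : State G) (h : holes M.1 = ∅) (e : Sym2 V) (he : e ∈ M.1) : State G :=
  ⟨M.1.erase e, M.2.1.subset (Finset.erase_subset _ _), Or.inr (by
    induction e with
    | _ p q => rw [M.2.1.holes_erase he, h]; exact Finset.card_pair (M.2.1.adj he).ne)⟩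

/-- The result of a move of the Broder chain from a near-perfect matching. -/
def State.near (M : State G) (h : holes M.1 ≠ ∅) (x w : V) (hw : w ∈ holes M.1) : State G :=
  ⟨nearMove G M.1 x w, by
    rcases M.2.1.nearMove_cases (State.card_holes_of_ne h) x w with h1 | ⟨-, h1, h2⟩ |
      ⟨y, h1, h2, h3⟩
    · rw [h1]; exact M.2
    · obtain ⟨p, q, hp, hq, hpq, h3⟩ := h1
      exact ⟨h3 ▸ M.2.1.insert_edge hp hq hpq, Or.inl (by rw [h2]; rfl)⟩
    · rw [h3]
      exact ⟨M.2.1.slide h1 hw h2, by rw [M.2.1.card_holes_slide h1 hw]; exact M.2.2⟩⟩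

theorem broder_nonneg (M N : State G) : 0 ≤ broder G M N := by
  unfold broder; split_ifs <;> positivity

theorem sum_broder [Nonempty V] (M : State G) : ∑ N, broder G M N = 1 := by
  unfold broder
  by_cases h : holes M.1 = ∅
  · simp only [if_pos h]
    have hc : (M.1.card : ℝ) ≠ 0 := by
      have h1 := M.2.1.two_mul_card h
      have h2 := Fintype.card_pos (α := V)
      exact_mod_cast (by omega : M.1.card ≠ 0)
    rw [← Finset.sum_div, div_eq_one_iff_eq hc, ← Nat.cast_sum, Nat.cast_inj]
    simp only [Finset.card_filter]
    rw [Finset.sum_comm, Finset.card_eq_sum_ones]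
    refine Finset.sum_congr rfl fun e he => ?_
    rw [Finset.sum_eq_single (M.erase h e he)]
    · exact if_pos rfl
    · exact fun N _ hN => if_neg fun h' => hN (State.ext h')
    · simp
  · simp only [if_neg h]
    have hc : ((Fintype.card V : ℝ) * ((holes M.1).card : ℝ)) ≠ 0 := by
      rw [State.card_holes_of_ne h]
      have h2 := Fintype.card_pos (α := V)
      positivity
    rw [← Finset.sum_div, div_eq_one_iff_eq hc, ← Nat.cast_sum, ← Nat.cast_mul, Nat.cast_inj,
      ← Finset.card_univ, ← Finset.card_product]
    simp only [Finset.card_filter]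
    rw [Finset.sum_comm, Finset.card_eq_sum_ones]
    refine Finset.sum_congr rfl fun p hp => ?_
    rw [Finset.sum_eq_single (M.near h p.1 p.2 (Finset.mem_product.1 hp).2)]
    · exact if_pos rfl
    · exact fun N _ hN => if_neg fun h' => hN (State.ext h')
    · simp

/-- Between distinct near-perfect matchings only slides contribute. Sending the choice `(x, p)` to
`(x, y)`, with `y` the old partner of `x`, maps choices for a move injectively to choices for its
inverse; used in both directions this gives symmetry. -/
theorem card_nearMove_le {M N : State G} (hM : holes M.1 ≠ ∅) (hN : holes N.1 ≠ ∅) (hne : M ≠ N) :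
    ((Finset.univ ×ˢ holes M.1).filter fun p : V × V => N.1 = nearMove G M.1 p.1 p.2).card ≤
    ((Finset.univ ×ˢ holes N.1).filter fun p : V × V => M.1 = nearMove G N.1 p.1 p.2).card := by
  have key : ∀ p ∈ (Finset.univ ×ˢ holes M.1).filter
      (fun p : V × V => N.1 = nearMove G M.1 p.1 p.2), ∃ y, s(p.1, y) ∈ M.1 ∧
        N.1 = insert s(p.1, p.2) (M.1.erase s(p.1, y)) := by
    intro p hp
    simp only [Finset.mem_filter, Finset.mem_product, Finset.mem_univ, true_and] at hp
    obtain ⟨hp1, hp2⟩ := hp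
    rcases M.2.1.nearMove_cases (State.card_holes_of_ne hM) p.1 p.2 with h1 | ⟨-, -, h2⟩ | h3
    · exact absurd (State.ext (h1.symm.trans hp2.symm)) hne
    · exact absurd (hp2 ▸ h2) hN
    · obtain ⟨y, h3, -, h5⟩ := h3
      exact ⟨y, h3, hp2.trans h5⟩
  have : Nonempty V := ⟨(Finset.nonempty_iff_ne_empty.2 hM).choose⟩
  choose! y hy1 hy3 using key
  refine Finset.card_le_card_of_injOn (fun p => (p.1, y p)) ?_ ?_
  · intro p hp
    have hw : p.2 ∈ holes M.1 := by
      simp only [Finset.coe_filter, Finset.mem_product, Set.mem_ofPred_eq] at hp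
      exact hp.1.2
    simp only [Finset.coe_filter, Finset.mem_product, Finset.mem_univ, true_and, Set.mem_ofPred_eq]
    refine ⟨?_, ?_⟩
    · rw [hy3 p hp, M.2.1.holes_slide (hy1 p hp) hw]; exact Finset.mem_insert_self _ _
    · rw [N.2.1.nearMove_slide (y := p.2) (by rw [hy3 p hp]; exact Finset.mem_insert_self _ _)
        (M.2.1.adj (hy1 p hp)), hy3 p hp]
      exact slide_slide (hy1 p hp) hw
  · intro p hp p' hp' h
    have h1 : p.1 = p'.1 := (Prod.ext_iff.1 h).1
    refine Prod.ext h1 ?_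
    have e1 : s(p.1, p.2) ∈ N.1 := by rw [hy3 p hp]; exact Finset.mem_insert_self _ _
    have e2 : s(p'.1, p'.2) ∈ N.1 := by rw [hy3 p' hp']; exact Finset.mem_insert_self _ _
    rw [← h1] at e2
    exact N.2.1.right_unique e1 e2

/-- With `n` vertices, a given edge is removed with probability `1 / (n / 2)`; conversely its ends
are the holes, and all four pairs of a hole `x` and a hole `w` add it, with probability `4 / (2 *
n)`. -/
theorem broder_perfect_near [Nonempty V] {M N : State G} (hM : holes M.1 = ∅)
    (hN : holes N.1 ≠ ∅) : broder G M N = broder G N M := by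
  unfold broder
  rw [if_pos hM, if_neg hN, State.card_holes_of_ne hN, ← M.2.1.two_mul_card hM]
  have hc : (M.1.card : ℝ) ≠ 0 := by
    have h1 := M.2.1.two_mul_card hM
    have h2 := Fintype.card_pos (α := V)
    exact_mod_cast (by omega : M.1.card ≠ 0)
  by_cases h : ∃ e ∈ M.1, N.1 = M.1.erase e
  · obtain ⟨e, he, h⟩ := h
    have h1 : (M.1.filter fun e => N.1 = M.1.erase e) = {e} := by
      ext f
      simp only [Finset.mem_filter, Finset.mem_singleton]
      constructor
      · rintro ⟨hf, h'⟩
        by_contra hne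
        have : f ∈ M.1.erase e := Finset.mem_erase.2 ⟨hne, hf⟩
        rw [← h, h'] at this
        simp at this
      · rintro rfl; exact ⟨he, h⟩
    have h2 : ((Finset.univ ×ˢ holes N.1).filter fun p : V × V => M.1 = nearMove G N.1 p.1 p.2) =
        holes N.1 ×ˢ holes N.1 := by
      ext ⟨x, w⟩
      simp only [Finset.mem_filter, Finset.mem_product, Finset.mem_univ, true_and]
      constructor
      · rintro ⟨hw, h'⟩
        refine ⟨?_, hw⟩
        rcases N.2.1.nearMove_cases (State.card_holes_of_ne hN) x w with h1 | ⟨h1, -, -⟩ |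
          ⟨y, h3, h4, h5⟩
        · exact absurd (by rw [← h1, ← h']; exact hM) hN
        · exact h1
        · have := N.2.1.card_holes_slide h3 hw
          rw [← h5, ← h', hM, State.card_holes_of_ne hN] at this
          simp at this
      · rintro ⟨hx, hw⟩
        refine ⟨hw, ?_⟩
        induction e with
        | _ p q =>
          have hh : holes N.1 = {p, q} := by rw [h, M.2.1.holes_erase he, hM]; rfl
          rw [nearMove_of_mem_adj hh (M.2.1.adj he) hx, h, Finset.insert_erase he]
    rw [h1, h2, Finset.card_product, State.card_holes_of_ne hN]
    push_cast
    simp only [Finset.card_singleton, Nat.cast_one]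
    field_simp
    norm_num
  · have h1 : (M.1.filter fun e => N.1 = M.1.erase e) = ∅ :=
      Finset.filter_eq_empty_iff.2 fun e he h' => h ⟨e, he, h'⟩
    have h2 : ((Finset.univ ×ˢ holes N.1).filter fun p : V × V => M.1 = nearMove G N.1 p.1 p.2) =
        ∅ := by
      refine Finset.filter_eq_empty_iff.2 ?_
      rintro ⟨x, w⟩ hw h'
      have hw := (Finset.mem_product.1 hw).2
      rcases N.2.1.nearMove_cases (State.card_holes_of_ne hN) x w with h1 | ⟨-, h1, -⟩ |
          ⟨y, h3, h4, h5⟩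
      · exact absurd (by rw [← h1, ← h']; exact hM) hN
      · simp only at h'
        obtain ⟨p, q, hp, hq, hpq, h1⟩ := h1
        rw [← h'] at h1
        refine h ⟨s(p, q), by rw [h1]; exact Finset.mem_insert_self _ _, ?_⟩
        rw [h1, Finset.erase_insert]
        exact fun hc => mem_holes.1 hp _ hc (Sym2.mem_mk_left _ _)
      · have := N.2.1.card_holes_slide h3 hw
        simp only at h'
        rw [← h5, ← h', hM, State.card_holes_of_ne hN] at this
        simp at this
    rw [h1, h2]; simp

theorem broder_perfect_perfect {M N : State G} (hM : holes M.1 = ∅) (hN : holes N.1 = ∅) :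
    broder G M N = 0 := by
  unfold broder
  rw [if_pos hM, Finset.filter_eq_empty_iff.2, Finset.card_empty, Nat.cast_zero, zero_div]
  intro e he h
  induction e with
  | _ p q =>
    rw [h, M.2.1.holes_erase he] at hN
    simp at hN

/-- The Broder chain is symmetric. -/
theorem broder_symm [Nonempty V] (M N : State G) : broder G M N = broder G N M := by
  by_cases hM : holes M.1 = ∅ <;> by_cases hN : holes N.1 = ∅
  · rw [broder_perfect_perfect hM hN, broder_perfect_perfect hN hM]
  · exact broder_perfect_near hM hN
  · exact (broder_perfect_near hN hM).symm
  · by_cases hne : M = N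
    · rw [hne]
    · unfold broder
      rw [if_neg hM, if_neg hN, State.card_holes_of_ne hM, State.card_holes_of_ne hN,
        le_antisymm (card_nearMove_le hM hN hne) (card_nearMove_le hN hM (Ne.symm hne))]

theorem step_of_broder_pos {M N : State G} (hne : M ≠ N) (h : 0 < broder G M N) :
    AddStep G M.1 N.1 ∨ AddStep G N.1 M.1 ∨ SlideStep G M.1 N.1 := by
  unfold broder at h
  split_ifs at h with hM
  · have : (M.1.filter fun e => N.1 = M.1.erase e).Nonempty := by
      by_contra hcon
      rw [Finset.not_nonempty_iff_eq_empty] at hcon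
      simp [hcon] at h
    obtain ⟨e, he⟩ := this
    obtain ⟨he, hN⟩ := Finset.mem_filter.1 he
    induction e with
    | _ p q =>
      refine Or.inr (Or.inl ⟨p, q, ?_, ?_, M.2.1.adj he, by rw [hN, Finset.insert_erase he]⟩) <;>
      · rw [hN, M.2.1.holes_erase he]; simp
  · have : ((Finset.univ ×ˢ holes M.1).filter
        fun p : V × V => N.1 = nearMove G M.1 p.1 p.2).Nonempty := by
      by_contra hcon
      rw [Finset.not_nonempty_iff_eq_empty] at hcon
      simp [hcon] at h
    obtain ⟨⟨x, w⟩, hp⟩ := this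
    obtain ⟨hp, hN⟩ := Finset.mem_filter.1 hp
    have hw := (Finset.mem_product.1 hp).2
    simp only at hN hw
    rcases M.2.1.nearMove_cases (State.card_holes_of_ne hM) x w with h1 | ⟨-, h1, -⟩ |
          ⟨y, h3, h4, h5⟩
    · exact absurd (State.ext (h1.symm.trans hN.symm)) hne
    · exact Or.inl (hN ▸ h1)
    · exact Or.inr (Or.inr ⟨x, y, w, h3, hw, h4, hN.trans h5⟩)

theorem broder_pos_of_nearMove {M N : State G} (hM : holes M.1 ≠ ∅) {x w : V} (hw : w ∈ holes M.1)
    (h : N.1 = nearMove G M.1 x w) : 0 < broder G M N := by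
  unfold broder
  rw [if_neg hM, State.card_holes_of_ne hM]
  have : 0 < ((Finset.univ ×ˢ holes M.1).filter
        fun p : V × V => N.1 = nearMove G M.1 p.1 p.2).card :=
    Finset.card_pos.2 ⟨(x, w), by simp [hw, h]⟩
  have hV : 0 < Fintype.card V := Fintype.card_pos_iff.2 ⟨x⟩
  positivity

theorem broder_pos_of_erase {M : State G} (hM : holes M.1 = ∅) {e : Sym2 V} (he : e ∈ M.1) :
    0 < broder G M (M.erase hM e he) := by
  unfold broder
  rw [if_pos hM]
  have h1 : 0 < (M.1.filter fun f => (M.erase hM e he).1 = M.1.erase f).card :=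
    Finset.card_pos.2 ⟨e, Finset.mem_filter.2 ⟨he, rfl⟩⟩
  have h2 : 0 < M.1.card := Finset.card_pos.2 ⟨e, he⟩
  positivity

/-- Progress of `M` towards the perfect matching `P`. -/
def progress (P M : State G) : ℕ :=
  2 * (M.1 ∩ P.1).card + if holes M.1 = ∅ then 0 else 1

theorem progress_le (P M : State G) : progress P M ≤ 2 * P.1.card + 1 := by
  have := Finset.card_le_card (Finset.inter_subset_right : M.1 ∩ P.1 ⊆ P.1)
  unfold progress; split_ifs <;> omega

/-- From a perfect `M`, removing an edge not in `P` gains the bonus 1 for having holes. From a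
near-perfect `M` with hole `p`, adding the `P`-edge at `p`, or sliding onto it, gains an edge of `P`
and loses none; its weight 2 outweighs a possible loss of the bonus. -/
theorem exists_progress {P M : State G} (hP : holes P.1 = ∅) (hne : M ≠ P) :
    ∃ N, 0 < broder G M N ∧ progress P M < progress P N := by
  by_cases hM : holes M.1 = ∅
  · obtain ⟨e, he, heP⟩ : ∃ e ∈ M.1, e ∉ P.1 := by
      by_contra hcon
      push Not at hcon
      refine hne (State.ext (Finset.Subset.antisymm hcon fun e he => ?_))
      induction e with
      | _ x y =>
        obtain ⟨z, hz⟩ := not_mem_holes.1 (hM ▸ Finset.notMem_empty x : x ∉ holes M.1)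
        rwa [P.2.1.right_unique he (hcon _ hz)]
    refine ⟨M.erase hM e he, broder_pos_of_erase hM he, ?_⟩
    have h1 : holes (M.erase hM e he).1 ≠ ∅ := by
      induction e with
      | _ x y => simp only [State.erase]; rw [M.2.1.holes_erase he]; simp
    have h2 : (M.erase hM e he).1 ∩ P.1 = M.1 ∩ P.1 := by
      simp only [State.erase]
      rw [Finset.erase_inter, Finset.erase_eq_of_notMem]
      simp [heP]
    unfold progress
    rw [if_pos hM, if_neg h1, h2]
    omega
  · obtain ⟨p, q, hpq, hh⟩ := Finset.card_eq_two.1 (State.card_holes_of_ne hM)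
    have hp : p ∈ holes M.1 := by simp [hh]
    obtain ⟨x, hx⟩ := not_mem_holes.1 (hP ▸ Finset.notMem_empty p : p ∉ holes P.1)
    have hpx : s(p, x) ∉ M.1 := fun h => not_mem_holes_left h hp
    by_cases hxq : x = q
    · subst hxq
      have hN := nearMove_of_mem_adj (w := p) hh (P.2.1.adj hx) hp
      refine ⟨M.near hM p p hp, broder_pos_of_nearMove hM hp rfl, ?_⟩
      have h1 : (M.near hM p p hp).1 = insert s(p, x) M.1 := hN
      have h2 : (M.near hM p p hp).1 ∩ P.1 = insert s(p, x) (M.1 ∩ P.1) := by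
        rw [h1, Finset.insert_inter_of_mem hx]
      unfold progress
      rw [h2, Finset.card_insert_of_notMem (by simp [hpx]), if_neg hM]
      omega
    · have hxM : x ∉ holes M.1 := by
        rw [hh]; simp only [Finset.mem_insert, Finset.mem_singleton, not_or]
        exact ⟨(P.2.1.adj hx).ne', hxq⟩
      obtain ⟨y, hy⟩ := not_mem_holes.1 hxM
      have hN := M.2.1.nearMove_slide hy (P.2.1.adj hx).symm
      refine ⟨M.near hM x p hp, broder_pos_of_nearMove hM hp rfl, ?_⟩
      have h1 : (M.near hM x p hp).1 = insert s(x, p) (M.1.erase s(x, y)) := hN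
      have hx' : s(x, p) ∈ P.1 := Sym2.eq_swap ▸ hx
      have hxyP : s(x, y) ∉ P.1 := fun h => by
        have := P.2.1.right_unique h hx'
        exact not_mem_holes_right hy (this ▸ hp)
      have h2 : (M.near hM x p hp).1 ∩ P.1 = insert s(x, p) (M.1 ∩ P.1) := by
        rw [h1, Finset.insert_inter_of_mem hx', Finset.erase_inter,
          Finset.erase_eq_of_notMem (a := s(x, y))]
        simp [hxyP]
      unfold progress
      rw [h2, Finset.card_insert_of_notMem (by rw [Sym2.eq_swap]; simp [hpx]), if_neg hM]
      split_ifs <;> omega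

theorem reachable_perfect {P : State G} (hP : holes P.1 = ∅) (M : State G) :
    Relation.ReflTransGen (fun M N : State G => 0 < broder G M N) M P := by
  induction h : 2 * P.1.card + 1 - progress P M using Nat.strong_induction_on generalizing M with
  | _ n ih =>
    by_cases hne : M = P
    · rw [hne]
    · obtain ⟨N, h1, h2⟩ := exists_progress hP hne
      have := progress_le P N
      exact Relation.ReflTransGen.head h1 (ih _ (by omega) N rfl)

/-- The Broder chain on a graph with a perfect matching is irreducible. -/
theorem broder_irreducible [Nonempty V] {P : State G} (hP : holes P.1 = ∅) (M N : State G) :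
    Relation.ReflTransGen (fun M N : State G => 0 < broder G M N) M N := by
  refine (reachable_perfect hP M).trans ?_
  rw [← Relation.reflTransGen_swap]
  refine Relation.ReflTransGen.mono (fun A B h => ?_) _ _ (reachable_perfect hP N)
  rwa [Function.swap, broder_symm]

end Broder

/-! ### The Metropolis filter and its stationary distribution -/

section Metropolis

variable {V : Type*} [Fintype V] [DecidableEq V] {G : SimpleGraph V} {w : State G → ℝ}

theorem metropolis_nonneg (hw : ∀ M, 0 < w M) (M N : State G) : 0 ≤ metropolis G w M N := by
  unfold metropolis
  refine add_nonneg (mul_nonneg (broder_nonneg _ _) ?_) ?_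
  · exact le_min zero_le_one (div_nonneg (hw _).le (hw _).le)
  · split_ifs
    · exact Finset.sum_nonneg fun K _ => mul_nonneg (broder_nonneg _ _)
        (sub_nonneg.2 (min_le_left _ _))
    · exact le_rfl

theorem sum_metropolis [Nonempty V] (M : State G) : ∑ N, metropolis G w M N = 1 := by
  unfold metropolis
  rw [Finset.sum_add_distrib, Finset.sum_ite_eq, if_pos (Finset.mem_univ _),
    ← Finset.sum_add_distrib]
  refine Eq.trans (Finset.sum_congr rfl fun N _ => ?_) (sum_broder M)
  ring

theorem metropolis_of_ne {M N : State G} (h : M ≠ N) :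
    metropolis G w M N = broder G M N * min 1 (w N / w M) := by
  unfold metropolis; rw [if_neg h, add_zero]

/-- The proposal is symmetric, and `w M * min 1 (w N / w M) = min (w M) (w N)` is symmetric as well.
-/
theorem metropolis_reversible [Nonempty V] (hw : ∀ M, 0 < w M) (M N : State G) :
    w M * metropolis G w M N = w N * metropolis G w N M := by
  by_cases h : M = N
  · rw [h]
  · have key : ∀ A B : State G, w A * min 1 (w B / w A) = min (w A) (w B) := fun A B => by
      rw [mul_min_of_nonneg _ _ (hw A).le, mul_one, mul_div_cancel₀ _ (hw A).ne']
    rw [metropolis_of_ne h, metropolis_of_ne (Ne.symm h), broder_symm N M, mul_left_comm, key,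
      mul_left_comm, key, min_comm]

theorem metropolis_pos_of_broder_pos (hw : ∀ M, 0 < w M) {M N : State G} (h : 0 < broder G M N) :
    0 < metropolis G w M N := by
  unfold metropolis
  refine add_pos_of_pos_of_nonneg (mul_pos h (lt_min one_pos (div_pos (hw _) (hw _)))) ?_
  split_ifs
  · exact Finset.sum_nonneg fun K _ => mul_nonneg (broder_nonneg _ _)
      (sub_nonneg.2 (min_le_left _ _))
  · exact le_rfl

theorem step_of_metropolis_ne_zero {M N : State G} (hne : M ≠ N) (h : metropolis G w M N ≠ 0) :
    AddStep G M.1 N.1 ∨ AddStep G N.1 M.1 ∨ SlideStep G M.1 N.1 := by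
  rw [metropolis_of_ne hne] at h
  exact step_of_broder_pos hne ((broder_nonneg M N).lt_of_ne' (left_ne_zero_of_mul h))

/-- If `G` has a perfect matching, the Metropolis chain has the unique stationary distribution
`w / ∑ w`. -/
theorem metropolis_stationary [Nonempty V] (hw : ∀ M, 0 < w M) {P : State G}
    (hP : holes P.1 = ∅) :
    IsStationary (metropolis G w) (fun M => w M / ∑ N, w N) ∧
      ∀ π', IsStationary (metropolis G w) π' → π' = fun M => w M / ∑ N, w N := by
  have hZ : 0 < ∑ N, w N := Finset.sum_pos (fun N _ => hw N) ⟨P, Finset.mem_univ _⟩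
  refine isStationary_and_unique_of_reversible (fun M => div_pos (hw M) hZ) ?_
    (metropolis_nonneg hw) sum_metropolis ?_ ?_
  · rw [← Finset.sum_div, div_self hZ.ne']
  · intro M N
    rw [div_mul_eq_mul_div, div_mul_eq_mul_div, metropolis_reversible hw]
  · intro M N
    exact Relation.ReflTransGen.mono (fun _ _ h => metropolis_pos_of_broder_pos hw h) _ _
      (broder_irreducible hP M N)

end Metropolis

/-! ### Adjacency in the graphs -/

section Adjacency

variable {k : ℕ}

/-- Adjacency of the cycle positions in the gadget. -/
def CycAdj (m m' : Fin 12) : Prop :=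
  m' = m + 1 ∨ m = m' + 1 ∨ (m = 0 ∧ m' = 6) ∨ (m = 6 ∧ m' = 0)

instance : DecidableRel CycAdj := fun _ _ => inferInstanceAs (Decidable (_ ∨ _))

/-- The end of the `c`-th chain of boxes on the chord: `a`, `a`, `b`, `b`. -/
def hub : Fin 4 → Fin 12 := ![0, 0, 6, 6]

/-- The other end of the `c`-th chain of boxes: `w₁`, `z₁`, `w₂`, `z₂`. -/
def tip : Fin 4 → Fin 12 := ![2, 10, 4, 8]

/-- The common neighbour of `hub c` and `tip c`: `x₁`, `y₁`, `x₂`, `y₂`. -/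
def mid : Fin 4 → Fin 12 := ![1, 11, 5, 7]

/-- The vertex `u` or `v` adjacent to `tip c`. -/
def pole : Fin 4 → Fin 12 := ![3, 9, 3, 9]

/-- The other chain of boxes with the same hub. -/
def twin : Fin 4 → Fin 4 := ![1, 0, 3, 2]

theorem BoxVertex.isEnd_v {i : Fin (2 * k)} :
    (BoxVertex.v i).IsEnd ↔ (i : ℕ) = 0 ∨ (i : ℕ) + 1 = 2 * k := Iff.rfl

theorem BoxVertex.not_isEnd_a {i : Fin k} : ¬ (BoxVertex.a i).IsEnd := fun h => h

theorem BoxVertex.not_isEnd_b {i : Fin k} : ¬ (BoxVertex.b i).IsEnd := fun h => h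

theorem chainMap_inner (c : Fin 4) (p : {p : BoxVertex k // ¬ p.IsEnd}) :
    chainMap k c p.1 = .inner c p := by
  rw [chainMap, dif_neg p.2]

theorem chainMap_of_not_isEnd (c : Fin 4) {p : BoxVertex k} (h : ¬ p.IsEnd) :
    chainMap k c p = .inner c ⟨p, h⟩ := by
  rw [chainMap, dif_neg h]

theorem chainMap_start (c : Fin 4) {i : Fin (2 * k)} (h : (i : ℕ) = 0) :
    chainMap k c (.v i) = .cyc (chainStart c) := by
  rw [chainMap, dif_pos (BoxVertex.isEnd_v.2 (Or.inl h)), if_pos ⟨i, rfl, h⟩]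

theorem chainMap_end (c : Fin 4) {i : Fin (2 * k)} (h : (i : ℕ) + 1 = 2 * k) :
    chainMap k c (.v i) = .cyc (chainEnd c) := by
  rw [chainMap, dif_pos (BoxVertex.isEnd_v.2 (Or.inr h)), if_neg]
  rintro ⟨j, hj, hj0⟩
  obtain rfl := BoxVertex.v.inj hj
  omega

theorem chainMap_isEnd (c : Fin 4) {p : BoxVertex k} (h : p.IsEnd) :
    chainMap k c p = .cyc (hub c) ∨ chainMap k c p = .cyc (tip c) := by
  rcases p with i | i | i
  · rcases h with h | h
    · rw [chainMap_start c h]; fin_cases c <;> simp [chainStart, hub, tip]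
    · rw [chainMap_end c h]; fin_cases c <;> simp [chainEnd, hub, tip]
  · exact h.elim
  · exact h.elim

theorem chainMap_injective (c : Fin 4) : Function.Injective (chainMap k c) := by
  have hne : chainStart c ≠ chainEnd c := by revert c; decide
  intro p q h
  by_cases hp : p.IsEnd <;> by_cases hq : q.IsEnd
  · rcases p with i | i | i
    · rcases q with j | j | j
      · rcases hp with hp | hp <;> rcases hq with hq | hq
        · congr 1; ext; omega
        · rw [chainMap_start c hp, chainMap_end c hq] at h
          exact absurd (GadgetVertex.cyc.inj h) hne
        · rw [chainMap_end c hp, chainMap_start c hq] at h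
          exact absurd (GadgetVertex.cyc.inj h).symm hne
        · congr 1; ext; omega
      · exact hq.elim
      · exact hq.elim
    · exact hp.elim
    · exact hp.elim
  · rw [chainMap_of_not_isEnd c hq] at h
    rcases chainMap_isEnd c hp with h' | h' <;> rw [h'] at h <;> cases h
  · rw [chainMap_of_not_isEnd c hp] at h
    rcases chainMap_isEnd c hq with h' | h' <;> rw [h'] at h <;> cases h
  · rw [chainMap_of_not_isEnd c hp, chainMap_of_not_isEnd c hq] at h
    simpa using h

/-- The (asymmetric) relation generating the chain of boxes. -/
def BoxRel (p q : BoxVertex k) : Prop :=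
  match p, q with
    | .v i, .v j => (i : ℕ) + 1 = j
    | .v i, .a j => (i : ℕ) = 2 * j
    | .a i, .b j => i = j
    | .b i, .v j => (j : ℕ) = 2 * i + 1
    | _, _ => False

theorem boxRel_irrefl (p : BoxVertex k) : ¬ BoxRel p p := by
  rcases p with i | i | i <;> simp [BoxRel]

theorem boxChain_adj {p q : BoxVertex k} :
    (boxChain k).Adj p q ↔ BoxRel p q ∨ BoxRel q p := by
  have h : (boxChain k).Adj p q ↔ p ≠ q ∧ (BoxRel p q ∨ BoxRel q p) := by
    rw [boxChain, SimpleGraph.fromRel_adj]; rfl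
  rw [h, and_iff_right_iff_imp]
  rintro h' rfl
  exact (boxRel_irrefl p) (h'.elim id id)

theorem cycAdj_symm {m m' : Fin 12} (h : CycAdj m m') : CycAdj m' m := by
  unfold CycAdj at *; tauto

theorem cycAdj_ne {m m' : Fin 12} (h : CycAdj m m') : m ≠ m' := by
  revert m m'; decide

theorem cycleGraph_adj_or {m m' : Fin 12} :
    CycAdj m m' ↔ (SimpleGraph.cycleGraph 12).Adj m m' ∨ (m = 0 ∧ m' = 6) ∨ (m = 6 ∧ m' = 0) := by
  rw [SimpleGraph.cycleGraph_adj]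
  revert m m'; decide

theorem gadget_adj_chainMap (c : Fin 4) {p q : BoxVertex k} (h : (boxChain k).Adj p q) :
    (gadget k).Adj (chainMap k c p) (chainMap k c q) := by
  rw [gadget, SimpleGraph.fromRel_adj]
  exact ⟨fun h' => h.ne (chainMap_injective c h'), Or.inl (Or.inr (Or.inr ⟨c, p, q, h, rfl, rfl⟩))⟩

theorem gadget_adj_cyc {m m' : Fin 12} (h : CycAdj m m') : (gadget k).Adj (.cyc m) (.cyc m') := by
  rw [gadget, SimpleGraph.fromRel_adj]
  refine ⟨fun h' => cycAdj_ne h (GadgetVertex.cyc.inj h'), ?_⟩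
  rcases cycleGraph_adj_or.1 h with h | ⟨rfl, rfl⟩ | ⟨rfl, rfl⟩
  · exact Or.inl (Or.inl ⟨m, m', h, rfl, rfl⟩)
  · exact Or.inl (Or.inr (Or.inl ⟨rfl, rfl⟩))
  · exact Or.inr (Or.inr (Or.inl ⟨rfl, rfl⟩))

theorem gadget_adj_iff {r s : GadgetVertex k} : (gadget k).Adj r s ↔
    (∃ m m', CycAdj m m' ∧ r = .cyc m ∧ s = .cyc m') ∨
    ∃ c p q, (boxChain k).Adj p q ∧ r = chainMap k c p ∧ s = chainMap k c q := by
  constructor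
  · rw [gadget, SimpleGraph.fromRel_adj]
    rintro ⟨-, (⟨m, m', h, rfl, rfl⟩ | ⟨rfl, rfl⟩ | h) | (⟨m, m', h, rfl, rfl⟩ | ⟨rfl, rfl⟩ | h)⟩
    · exact Or.inl ⟨m, m', cycleGraph_adj_or.2 (Or.inl h), rfl, rfl⟩
    · exact Or.inl ⟨0, 6, by decide, rfl, rfl⟩
    · exact Or.inr h
    · exact Or.inl ⟨m', m, cycAdj_symm (cycleGraph_adj_or.2 (Or.inl h)), rfl, rfl⟩
    · exact Or.inl ⟨6, 0, by decide, rfl, rfl⟩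
    · obtain ⟨c, p, q, h, rfl, rfl⟩ := h
      exact Or.inr ⟨c, q, p, h.symm, rfl, rfl⟩
  · rintro (⟨m, m', h, rfl, rfl⟩ | ⟨c, p, q, h, rfl, rfl⟩)
    · exact gadget_adj_cyc h
    · exact gadget_adj_chainMap c h

theorem gadget_adj_inner {c : Fin 4} {p : {p : BoxVertex k // ¬ p.IsEnd}} {r : GadgetVertex k} :
    (gadget k).Adj (.inner c p) r ↔ ∃ q, (boxChain k).Adj p.1 q ∧ r = chainMap k c q := by
  constructor
  · rw [gadget_adj_iff]
    rintro (⟨m, m', -, h, -⟩ | ⟨c', p', q, h, h1, rfl⟩)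
    · cases h
    · have hp' : ¬ p'.IsEnd := by
        intro hp'
        rcases chainMap_isEnd c' hp' with h' | h' <;> rw [h'] at h1 <;> cases h1
      rw [chainMap_of_not_isEnd c' hp'] at h1
      cases h1
      exact ⟨q, h, rfl⟩
  · rintro ⟨q, h, rfl⟩
    rw [← chainMap_inner]
    exact gadget_adj_chainMap c h

/-- For `k = 1` the path edge `v 0, v 1` joins the two ends directly. Longer chains add no edges
among the vertices of the twelve-cycle, so adjacency there is just `CycAdj`. -/
theorem boxChain_not_adj_ends (hk : 2 ≤ k) {p q : BoxVertex k} (hp : p.IsEnd) (hq : q.IsEnd) :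
    ¬ (boxChain k).Adj p q := by
  rw [boxChain_adj]
  rcases p with i | i | i
  · rcases q with j | j | j
    · rw [BoxVertex.isEnd_v] at hp hq
      simp only [BoxRel]
      omega
    · exact hq.elim
    · exact hq.elim
  · exact hp.elim
  · exact hp.elim

theorem gadget_adj_cyc_cases (hk : 2 ≤ k) {m : Fin 12} {r : GadgetVertex k}
    (h : (gadget k).Adj (.cyc m) r) : (∃ m', CycAdj m m' ∧ r = .cyc m') ∨
      ∃ c p, r = .inner c p ∧ (m = hub c ∨ m = tip c) := by
  rcases r with m' | ⟨c, p⟩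
  · left
    rcases gadget_adj_iff.1 h with ⟨m1, m2, h1, h2, h3⟩ | ⟨c, p, q, h1, h2, h3⟩
    · cases h2; cases h3
      exact ⟨m', h1, rfl⟩
    · exfalso
      refine boxChain_not_adj_ends hk ?_ ?_ h1
      · by_contra hp; rw [chainMap_of_not_isEnd c hp] at h2; cases h2
      · by_contra hp; rw [chainMap_of_not_isEnd c hp] at h3; cases h3
  · right
    obtain ⟨q, -, hq⟩ := gadget_adj_inner.1 h.symm
    refine ⟨c, p, rfl, ?_⟩
    have hqe : q.IsEnd := by
      by_contra hp; rw [chainMap_of_not_isEnd c hp] at hq; cases hq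
    rcases chainMap_isEnd c hqe with h' | h' <;> rw [h'] at hq <;> cases hq <;> simp

@[simp]
theorem adj_copy_copy {i j : Fin 4} {r s : GadgetVertex k} :
    (counterexampleGraph k).Adj (.copy i r) (.copy j s) ↔ i = j ∧ (gadget k).Adj r s := by
  rw [counterexampleGraph, SimpleGraph.fromRel_adj]
  constructor
  · rintro ⟨-, h | h⟩
    exacts [h, ⟨h.1.symm, h.2.symm⟩]
  · intro h
    exact ⟨fun h' => h.2.ne (GVertex.copy.inj h').2, Or.inl h⟩

@[simp]
theorem adj_t_copy {i j : Fin 4} {r : GadgetVertex k} :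
    (counterexampleGraph k).Adj (.t i) (.copy j r) ↔
      (r = .cyc 3 ∧ j = i) ∨ (r = .cyc 9 ∧ j = i - 1) := by
  rw [counterexampleGraph, SimpleGraph.fromRel_adj]
  constructor
  · rintro ⟨-, h | h⟩
    exacts [h, h.elim]
  · intro h
    exact ⟨by simp, Or.inl h⟩

@[simp]
theorem not_adj_t_t {i j : Fin 4} : ¬ (counterexampleGraph k).Adj (.t i) (.t j) := by
  rw [counterexampleGraph, SimpleGraph.fromRel_adj]
  rintro ⟨-, h | h⟩ <;> exact h

/-- The vertex of the `j`-th copy of the gadget at position `m` of the twelve-cycle. -/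
abbrev cy (j : Fin 4) (m : Fin 12) : GVertex k := .copy j (.cyc m)

/-- An inner vertex of the `c`-th chain of boxes in the `j`-th copy of the gadget. -/
abbrev inn (j c : Fin 4) (p : {p : BoxVertex k // ¬ p.IsEnd}) : GVertex k := .copy j (.inner c p)

/-- The index of the vertex `t` adjacent to `pole c` in the `j`-th copy of the gadget. -/
def poleT (j c : Fin 4) : Fin 4 := if pole c = 3 then j else j + 1

theorem nbr_t {i : Fin 4} {y : GVertex k} (h : (counterexampleGraph k).Adj (.t i) y) :
    y = cy i 3 ∨ y = cy (i - 1) 9 := by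
  rcases y with j | ⟨j, r⟩
  · exact absurd h not_adj_t_t
  · rcases adj_t_copy.1 h with ⟨rfl, rfl⟩ | ⟨rfl, rfl⟩ <;> simp

theorem nbr_copy_t {j i : Fin 4} {r : GadgetVertex k}
    (h : (counterexampleGraph k).Adj (.copy j r) (.t i)) :
    (r = .cyc 3 ∧ i = j) ∨ (r = .cyc 9 ∧ i = j + 1) := by
  rcases adj_t_copy.1 h.symm with ⟨rfl, rfl⟩ | ⟨rfl, rfl⟩ <;> simp

/-- A neighbour of a vertex of a copy of the gadget lies in the same copy or is a `t`. -/
theorem nbr_copy {j : Fin 4} {r : GadgetVertex k} {y : GVertex k}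
    (h : (counterexampleGraph k).Adj (.copy j r) y) :
    (∃ s, y = .copy j s ∧ (gadget k).Adj r s) ∨
      (r = .cyc 3 ∧ y = .t j) ∨ (r = .cyc 9 ∧ y = .t (j + 1)) := by
  rcases y with i | ⟨i, s⟩
  · rcases nbr_copy_t h with ⟨rfl, rfl⟩ | ⟨rfl, rfl⟩ <;> simp
  · obtain ⟨rfl, h'⟩ := adj_copy_copy.1 h
    exact Or.inl ⟨s, rfl, h'⟩

theorem nbr_cy (hk : 2 ≤ k) {j : Fin 4} {m : Fin 12} {y : GVertex k}
    (h : (counterexampleGraph k).Adj (cy j m) y) :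
    (∃ m', CycAdj m m' ∧ y = cy j m') ∨ (∃ c p, y = inn j c p ∧ (m = hub c ∨ m = tip c)) ∨
      (m = 3 ∧ y = .t j) ∨ (m = 9 ∧ y = .t (j + 1)) := by
  rcases nbr_copy h with ⟨s, rfl, hs⟩ | ⟨hm, rfl⟩ | ⟨hm, rfl⟩
  · rcases gadget_adj_cyc_cases hk hs with ⟨m', h1, rfl⟩ | ⟨c, p, rfl, h1⟩
    · exact Or.inl ⟨m', h1, rfl⟩
    · exact Or.inr (Or.inl ⟨c, p, rfl, h1⟩)
  · cases hm; simp
  · cases hm; simp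

theorem nbr_mid (hk : 2 ≤ k) {j c : Fin 4} {y : GVertex k}
    (h : (counterexampleGraph k).Adj (cy j (mid c)) y) : y = cy j (hub c) ∨ y = cy j (tip c) := by
  rcases nbr_cy hk h with ⟨m', h1, rfl⟩ | ⟨c', p, rfl, h1⟩ | ⟨h1, -⟩ | ⟨h1, -⟩
  · have : m' = hub c ∨ m' = tip c := by clear h; revert c m'; decide
    rcases this with rfl | rfl <;> simp
  · exfalso; clear h; revert c c'; decide
  · exfalso; clear h; revert c; decide
  · exfalso; clear h; revert c; decide

theorem nbr_tip (hk : 2 ≤ k) {j c : Fin 4} {y : GVertex k}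
    (h : (counterexampleGraph k).Adj (cy j (tip c)) y) :
    y = cy j (mid c) ∨ y = cy j (pole c) ∨ ∃ p, y = inn j c p := by
  rcases nbr_cy hk h with ⟨m', h1, rfl⟩ | ⟨c', p, rfl, h1⟩ | ⟨h1, -⟩ | ⟨h1, -⟩
  · have : m' = mid c ∨ m' = pole c := by clear h; revert c m'; decide
    rcases this with rfl | rfl <;> simp
  · have : c' = c := by clear h; revert c c'; decide
    subst this; exact Or.inr (Or.inr ⟨p, rfl⟩)
  · exfalso; clear h; revert c; decide
  · exfalso; clear h; revert c; decide

theorem nbr_hub (hk : 2 ≤ k) {j c : Fin 4} {y : GVertex k}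
    (h : (counterexampleGraph k).Adj (cy j (hub c)) y) :
    y = cy j (mid c) ∨ y = cy j (mid (twin c)) ∨ y = cy j (hub (c + 2)) ∨
      (∃ p, y = inn j c p) ∨ ∃ p, y = inn j (twin c) p := by
  rcases nbr_cy hk h with ⟨m', h1, rfl⟩ | ⟨c', p, rfl, h1⟩ | ⟨h1, -⟩ | ⟨h1, -⟩
  · have : m' = mid c ∨ m' = mid (twin c) ∨ m' = hub (c + 2) := by clear h; revert c m'; decide
    rcases this with rfl | rfl | rfl <;> simp
  · have : c' = c ∨ c' = twin c := by clear h; revert c c'; decide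
    rcases this with rfl | rfl <;> simp
  · exfalso; clear h; revert c; decide
  · exfalso; clear h; revert c; decide

theorem nbr_pole (hk : 2 ≤ k) {j c : Fin 4} {y : GVertex k}
    (h : (counterexampleGraph k).Adj (cy j (pole c)) y) :
    y = cy j (tip c) ∨ y = cy j (tip (c + 2)) ∨ y = .t (poleT j c) := by
  rcases nbr_cy hk h with ⟨m', h1, rfl⟩ | ⟨c', p, rfl, h1⟩ | ⟨h1, rfl⟩ | ⟨h1, rfl⟩
  · have : m' = tip c ∨ m' = tip (c + 2) := by clear h; revert c m'; decide
    rcases this with rfl | rfl <;> simp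
  · exfalso; clear h; revert c c'; decide
  · simp [poleT, h1]
  · simp [poleT, h1]

theorem nbr_inn {j c : Fin 4} {p : {p : BoxVertex k // ¬ p.IsEnd}} {y : GVertex k}
    (h : (counterexampleGraph k).Adj (inn j c p) y) :
    ∃ q, (boxChain k).Adj p.1 q ∧ y = .copy j (chainMap k c q) := by
  rcases nbr_copy h with ⟨s, rfl, hs⟩ | ⟨hm, rfl⟩ | ⟨hm, rfl⟩
  · obtain ⟨q, hq, rfl⟩ := gadget_adj_inner.1 hs
    exact ⟨q, hq, rfl⟩
  · cases hm
  · cases hm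

theorem nbr_inn_cases {j c : Fin 4} {p : {p : BoxVertex k // ¬ p.IsEnd}} {y : GVertex k}
    (h : (counterexampleGraph k).Adj (inn j c p) y) :
    (∃ q, y = inn j c q) ∨ y = cy j (hub c) ∨ y = cy j (tip c) := by
  obtain ⟨q, -, rfl⟩ := nbr_inn h
  by_cases hq : q.IsEnd
  · rcases chainMap_isEnd c hq with h' | h' <;> rw [h'] <;> simp
  · rw [chainMap_of_not_isEnd c hq]; simp

end Adjacency

/-! ### Vertex counts -/

section Cardinalities

variable {k : ℕ}

/-- The vertices of the chain of boxes as a sum type. -/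
def boxVertexEquiv (k : ℕ) : BoxVertex k ≃ Fin (2 * k) ⊕ Fin k ⊕ Fin k where
  toFun | .v i => .inl i | .a i => .inr (.inl i) | .b i => .inr (.inr i)
  invFun | .inl i => .v i | .inr (.inl i) => .a i | .inr (.inr i) => .b i
  left_inv := by rintro (i | i | i) <;> rfl
  right_inv := by rintro (i | i | i) <;> rfl

/-- The vertices of the gadget as a sum type. -/
def gadgetVertexEquiv (k : ℕ) :
    GadgetVertex k ≃ Fin 12 ⊕ Fin 4 × {p : BoxVertex k // ¬ p.IsEnd} where
  toFun | .cyc i => .inl i | .inner c p => .inr (c, p)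
  invFun | .inl i => .cyc i | .inr (c, p) => .inner c p
  left_inv := by rintro (i | ⟨c, p⟩) <;> rfl
  right_inv := by rintro (i | ⟨c, p⟩) <;> rfl

/-- The vertices of the counterexample graph as a sum type. -/
def gVertexEquiv (k : ℕ) : GVertex k ≃ Fin 4 ⊕ Fin 4 × GadgetVertex k where
  toFun | .t i => .inl i | .copy i p => .inr (i, p)
  invFun | .inl i => .t i | .inr (i, p) => .copy i p
  left_inv := by rintro (i | ⟨c, p⟩) <;> rfl
  right_inv := by rintro (i | ⟨c, p⟩) <;> rfl

theorem card_boxVertex : Fintype.card (BoxVertex k) = 4 * k := by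
  rw [Fintype.card_congr (boxVertexEquiv k)]; simp; ring

theorem card_isEnd (hk : 1 ≤ k) : Fintype.card {p : BoxVertex k // p.IsEnd} = 2 := by
  rw [Fintype.card_subtype]
  have : (Finset.univ.filter fun p : BoxVertex k => p.IsEnd) =
      {.v ⟨0, by omega⟩, .v ⟨2 * k - 1, by omega⟩} := by
    ext p
    rcases p with i | i | i
    · simp only [Finset.mem_filter, Finset.mem_univ, true_and, BoxVertex.isEnd_v,
        Finset.mem_insert, Finset.mem_singleton, BoxVertex.v.injEq, Fin.ext_iff]
      omega
    · simp [BoxVertex.not_isEnd_a]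
    · simp [BoxVertex.not_isEnd_b]
  rw [this, Finset.card_pair]
  simp only [ne_eq, BoxVertex.v.injEq, Fin.ext_iff]
  omega

theorem card_inner (hk : 1 ≤ k) :
    Fintype.card {p : BoxVertex k // ¬ p.IsEnd} = 4 * k - 2 := by
  rw [Fintype.card_subtype_compl, card_isEnd hk, card_boxVertex]

theorem card_gadgetVertex (hk : 1 ≤ k) : Fintype.card (GadgetVertex k) = 16 * k + 4 := by
  rw [Fintype.card_congr (gadgetVertexEquiv k), Fintype.card_sum, Fintype.card_prod, card_inner hk]
  simp only [Fintype.card_fin]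
  omega

theorem card_gVertex (hk : 1 ≤ k) : Fintype.card (GVertex k) = 64 * k + 20 := by
  rw [Fintype.card_congr (gVertexEquiv k), Fintype.card_sum, Fintype.card_prod,
    card_gadgetVertex hk]
  simp only [Fintype.card_fin]
  omega

end Cardinalities

/-! ### Parity arguments -/

section Parity

variable {V : Type*} [Fintype V] [DecidableEq V] {G : SimpleGraph V} {M : Finset (Sym2 V)}

/-- A set of vertices matched among themselves has even size. -/
theorem IsMatching.even_card_of_closed (hM : IsMatching G M) {Y : Finset V}
    (h : ∀ x ∈ Y, ∃ y ∈ Y, s(x, y) ∈ M) : Even Y.card := by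
  choose! f hf1 hf2 using h
  -- The partner map is a fixed-point-free involution of `Y`, so the ones cancel in pairs modulo 2.
  have hsum : ∑ _x ∈ Y, (1 : ZMod 2) = 0 := by
    refine Finset.sum_involution (fun x _ => f x) (fun _ _ => by decide) ?_ hf1 ?_
    · intro x hx _ hfx
      have := (hM.adj (hf2 x hx)).ne
      exact this hfx.symm
    · intro x hx
      exact hM.right_unique (hf2 (f x) (hf1 x hx)) (Sym2.eq_swap ▸ hf2 x hx)
  rw [Finset.sum_const, nsmul_eq_mul, mul_one] at hsum
  exact (ZMod.natCast_eq_zero_iff_even).1 hsum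

/-- If `X` is a set of even size without holes whose matching edges leave it only towards `α` and
`β`, and `α` is matched into `X`, then so is `β`. -/
theorem IsMatching.matched_into_of_even (hM : IsMatching G M) {X : Finset V} {α β : V}
    (hX : Even X.card) (hα : α ∉ X) (hh : ∀ x ∈ X, x ∉ holes M)
    (hout : ∀ x ∈ X, ∀ y, s(x, y) ∈ M → y ∈ X ∨ y = α ∨ y = β) (h : ∃ x ∈ X, s(α, x) ∈ M) :
    ∃ x ∈ X, s(β, x) ∈ M := by
  by_contra hcon
  push Not at hcon
  -- Without an edge from `β` into `X`, the set `X ∪ {α}` would be matched within itself, although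
  -- its size is odd.
  have : Even (insert α X).card := by
    refine hM.even_card_of_closed fun x hx => ?_
    rcases Finset.mem_insert.1 hx with rfl | hx
    · obtain ⟨y, hy, hxy⟩ := h
      exact ⟨y, Finset.mem_insert_of_mem hy, hxy⟩
    · obtain ⟨y, hy⟩ := not_mem_holes.1 (hh x hx)
      refine ⟨y, ?_, hy⟩
      rcases hout x hx y hy with h1 | rfl | rfl
      · exact Finset.mem_insert_of_mem h1
      · exact Finset.mem_insert_self _ _
      · exact absurd (Sym2.eq_swap ▸ hy) (hcon x hx)
  rw [Finset.card_insert_of_notMem hα] at this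
  exact (Nat.even_add_one.1 this) hX

end Parity

/-! ### Parity in chains of boxes and in gadgets -/

section GadgetParity

variable {k : ℕ} {M : Finset (Sym2 (GVertex k))}

/-- The inner vertices of a chain of boxes. -/
def innSet (k : ℕ) (j c : Fin 4) : Finset (GVertex k) := Finset.univ.image (inn j c)

theorem mem_innSet {j c : Fin 4} {x : GVertex k} : x ∈ innSet k j c ↔ ∃ p, x = inn j c p := by
  simp [innSet, eq_comm]

theorem even_card_innSet (hk : 1 ≤ k) (j c : Fin 4) : Even (innSet k j c).card := by
  rw [innSet, Finset.card_image_of_injective, Finset.card_univ, card_inner hk]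
  · exact ⟨2 * k - 1, by omega⟩
  · intro p q h
    simpa using h

/-- If a chain of boxes has no inner hole, then its hub is matched into it if and only if its tip
is. -/
theorem hub_matched_iff_tip_matched (hk : 1 ≤ k) (hM : IsMatching (counterexampleGraph k) M)
    {j c : Fin 4} (hh : ∀ p, inn j c p ∉ holes M) :
    (∃ p, s(cy j (hub c), inn j c p) ∈ M) ↔ ∃ p, s(cy j (tip c), inn j c p) ∈ M := by
  have conv : ∀ x : GVertex k, (∃ p, s(x, inn j c p) ∈ M) ↔ ∃ y ∈ innSet k j c, s(x, y) ∈ M := by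
    intro x
    simp only [mem_innSet]
    constructor
    · rintro ⟨p, hp⟩; exact ⟨_, ⟨p, rfl⟩, hp⟩
    · rintro ⟨_, ⟨p, rfl⟩, hp⟩; exact ⟨p, hp⟩
  have hh' : ∀ x ∈ innSet k j c, x ∉ holes M := by
    intro x hx
    obtain ⟨p, rfl⟩ := mem_innSet.1 hx
    exact hh p
  have hout : ∀ x ∈ innSet k j c, ∀ y, s(x, y) ∈ M →
      y ∈ innSet k j c ∨ y = cy j (hub c) ∨ y = cy j (tip c) := by
    intro x hx y hxy
    obtain ⟨p, rfl⟩ := mem_innSet.1 hx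
    rw [mem_innSet]
    exact nbr_inn_cases (hM.adj hxy)
  rw [conv, conv]
  constructor
  · exact hM.matched_into_of_even (even_card_innSet hk j c) (by simp [mem_innSet]) hh' hout
  · refine hM.matched_into_of_even (even_card_innSet hk j c) (by simp [mem_innSet]) hh' ?_
    exact fun x hx y hxy => (hout x hx y hxy).imp_right Or.symm

/-- If all vertices of a copy of the gadget except possibly one are matched, and not to this one,
then an odd number of them remains, and one of them is matched to the outside. -/
theorem exit_of_odd (hk : 1 ≤ k) (hM : IsMatching (counterexampleGraph k) M) {j : Fin 4}
    {e : GadgetVertex k} (hh : ∀ r, r ≠ e → .copy j r ∉ holes M)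
    (he : ∀ r, s(.copy j r, .copy j e) ∉ M) :
    (e ≠ .cyc 3 ∧ s(.t j, cy j 3) ∈ M) ∨ (e ≠ .cyc 9 ∧ s(.t (j + 1), cy j 9) ∈ M) := by
  by_contra hcon
  push Not at hcon
  set Y : Finset (GVertex k) := (Finset.univ.erase e).image (GVertex.copy j) with hY
  have hinj : Function.Injective (GVertex.copy (k := k) j) := fun a b h => (GVertex.copy.inj h).2
  have hcard : Y.card = 16 * k + 3 := by
    rw [hY, Finset.card_image_of_injective _ hinj, Finset.card_erase_of_mem (Finset.mem_univ _),
      Finset.card_univ, card_gadgetVertex hk]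
    rfl
  -- If neither exit were used, the `16 * k + 3` vertices other than `e` would be matched among
  -- themselves.
  have hev : Even Y.card := by
    refine hM.even_card_of_closed fun x hx => ?_
    obtain ⟨r, hr, rfl⟩ := Finset.mem_image.1 hx
    have hre := Finset.ne_of_mem_erase hr
    obtain ⟨y, hy⟩ := not_mem_holes.1 (hh r hre)
    refine ⟨y, ?_, hy⟩
    rcases nbr_copy (hM.adj hy) with ⟨s, rfl, hs⟩ | ⟨rfl, rfl⟩ | ⟨rfl, rfl⟩
    · refine Finset.mem_image_of_mem _ (Finset.mem_erase.2 ⟨?_, Finset.mem_univ _⟩)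
      rintro rfl
      exact he r hy
    · exact absurd (Sym2.eq_swap ▸ hy) (hcon.1 (Ne.symm hre))
    · exact absurd (Sym2.eq_swap ▸ hy) (hcon.2 (Ne.symm hre))
  rw [hcard] at hev
  obtain ⟨m, hm⟩ := hev
  omega

/-- In a copy of the gadget without holes, `u` is matched to the outside if and only if `v` is. -/
theorem exit_u_iff_exit_v (hk : 1 ≤ k) (hM : IsMatching (counterexampleGraph k) M) {j : Fin 4}
    (hh : ∀ r, .copy j r ∉ holes M) : s(.t j, cy j 3) ∈ M ↔ s(.t (j + 1), cy j 9) ∈ M := by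
  have hno : ∀ {m : Fin 12} {i : Fin 4}, s(.t i, cy j m) ∈ M →
      ∀ r, s(.copy j r, .copy j (.cyc m)) ∉ M := by
    intro m i h r hr
    have := hM.right_unique (Sym2.eq_swap ▸ hr) (Sym2.eq_swap ▸ h)
    cases this
  constructor
  · intro h
    -- Taking `u` itself as the exceptional vertex leaves `v` as the only possible exit.
    rcases exit_of_odd hk hM (fun r _ => hh r) (hno h) with ⟨h1, -⟩ | ⟨-, h1⟩
    exacts [absurd rfl h1, h1]
  · intro h
    rcases exit_of_odd hk hM (fun r _ => hh r) (hno h) with ⟨-, h1⟩ | ⟨h1, -⟩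
    exacts [h1, absurd rfl h1]

end GadgetParity

/-! ### The cut -/

section Flags

variable {k : ℕ} {M N : Finset (Sym2 (GVertex k))}

/-- The holes in the `j`-th copy of the gadget. -/
def gadgetHoles (M : Finset (Sym2 (GVertex k))) (j : Fin 4) : Finset (GadgetVertex k) :=
  Finset.univ.filter fun r => .copy j r ∈ holes M

theorem mem_gadgetHoles {j : Fin 4} {r : GadgetVertex k} :
    r ∈ gadgetHoles M j ↔ .copy j r ∈ holes M := by simp [gadgetHoles]

/-- Whether the `j`-th copy of the gadget is close to a configuration with both `u` and `v` matched
to the outside. -/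
def Flag (M : Finset (Sym2 (GVertex k))) (j : Fin 4) : Prop :=
  if (gadgetHoles M j).card = 1 then .cyc 3 ∈ gadgetHoles M j ∨ .cyc 9 ∈ gadgetHoles M j
  else s(.t j, cy j 3) ∈ M

/-- The bottleneck configurations: the only hole of the `j`-th copy of the gadget is `mid c`, and
`tip c` is matched to `pole c`. -/
def Rare (M : Finset (Sym2 (GVertex k))) (j c : Fin 4) : Prop :=
  gadgetHoles M j = {.cyc (mid c)} ∧ s(cy j (pole c), cy j (tip c)) ∈ M

theorem flag_of_card_ne {j : Fin 4} (h : (gadgetHoles M j).card ≠ 1) :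
    Flag M j ↔ s(.t j, cy j 3) ∈ M := by rw [Flag, if_neg h]

theorem flag_of_eq_empty {j : Fin 4} (h : gadgetHoles M j = ∅) :
    Flag M j ↔ s(.t j, cy j 3) ∈ M := flag_of_card_ne (by rw [h]; simp)

theorem flag_of_eq_singleton {j : Fin 4} {r : GadgetVertex k} (h : gadgetHoles M j = {r}) :
    Flag M j ↔ r = .cyc 3 ∨ r = .cyc 9 := by
  rw [Flag, if_pos (by rw [h]; simp), h]; simp [eq_comm]

theorem gadgetHoles_eq_empty {j : Fin 4} (h : gadgetHoles M j = ∅) (r : GadgetVertex k) :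
    .copy j r ∉ holes M := by
  rw [← mem_gadgetHoles, h]; simp

theorem card_gadgetHoles_le (j : Fin 4) : (gadgetHoles M j).card ≤ (holes M).card :=
  Finset.card_le_card_of_injOn (GVertex.copy j) (fun _ hr => mem_gadgetHoles.1 hr)
    fun _ _ _ _ h => (GVertex.copy.inj h).2

theorem exists_eq_copy_of_card_eq_two (hc : (holes M).card ≤ 2) {j : Fin 4}
    (h : (gadgetHoles M j).card = 2) {x : GVertex k} (hx : x ∈ holes M) : ∃ r, x = .copy j r := by
  have hsub : (gadgetHoles M j).image (GVertex.copy j) ⊆ holes M := by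
    intro y hy
    obtain ⟨r, hr, rfl⟩ := Finset.mem_image.1 hy
    exact mem_gadgetHoles.1 hr
  have hcard : ((gadgetHoles M j).image (GVertex.copy j)).card = 2 := by
    rw [Finset.card_image_of_injective, h]
    exact fun a b h => (GVertex.copy.inj h).2
  rw [← Finset.eq_of_subset_of_card_le hsub (by rw [hcard]; exact hc)] at hx
  obtain ⟨r, -, rfl⟩ := Finset.mem_image.1 hx
  exact ⟨r, rfl⟩

/-- When the holes lie in one copy of the gadget, the flags alternate around the circle. -/
theorem flag_alternate (hk : 1 ≤ k) (hM : IsMatching (counterexampleGraph k) M) {j₀ : Fin 4}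
    (hh : ∀ x ∈ holes M, ∃ r, x = .copy j₀ r) (hc : (gadgetHoles M j₀).card ≠ 1) (j : Fin 4) :
    Flag M (j + 1) ↔ ¬ Flag M j := by
  have hemp : ∀ i, i ≠ j₀ → gadgetHoles M i = ∅ := by
    intro i hi
    ext r
    simp only [mem_gadgetHoles, Finset.notMem_empty, iff_false]
    intro hr
    obtain ⟨s, hs⟩ := hh _ hr
    exact hi (GVertex.copy.inj hs).1
  have hflag : ∀ i, Flag M i ↔ s(.t i, cy i 3) ∈ M := by
    intro i
    by_cases hi : i = j₀
    · rw [flag_of_card_ne (by rw [hi]; exact hc)]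
    · rw [flag_of_eq_empty (hemp i hi)]
  -- The vertex `t (i + 1)` lies between `v` of copy `i` and `u` of copy `i + 1` and is matched to
  -- exactly one of them; parity in the hole-free copy `i` transfers this from `v` to `u`.
  have hstep : ∀ i, i ≠ j₀ → (Flag M (i + 1) ↔ ¬ Flag M i) := by
    intro i hi
    rw [hflag, hflag, exit_u_iff_exit_v hk hM (gadgetHoles_eq_empty (hemp i hi))]
    constructor
    · intro h h'
      have := hM.right_unique h h'
      simp at this
    · intro h
      have ht : GVertex.t (i + 1) ∉ holes M := by
        intro ht
        obtain ⟨r, hr⟩ := hh _ ht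
        cases hr
      obtain ⟨y, hy⟩ := not_mem_holes.1 ht
      rcases nbr_t (hM.adj hy) with rfl | rfl
      · exact hy
      · rw [add_sub_cancel_right] at hy
        exact absurd hy h
  by_cases hj : j = j₀
  · subst hj
    -- Parity says nothing in the copy that may contain the holes, but three alternations around a
    -- circle of length four imply the fourth.
    have key : ∀ a b c d : Prop, (c ↔ ¬ b) → (d ↔ ¬ c) → (a ↔ ¬ d) → (b ↔ ¬ a) := by
      clear * -
      intro a b c d h1 h2 h3
      rw [h3, h2, h1, not_not, not_not]
    have hne : ∀ i : Fin 4, i + 1 ≠ i ∧ i + 1 + 1 ≠ i ∧ i + 1 + 1 + 1 ≠ i ∧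
      i + 1 + 1 + 1 + 1 = i := by decide
    have h3 := hstep (j + 1 + 1 + 1) (hne j).2.2.1
    rw [(hne j).2.2.2] at h3
    exact key _ _ _ _ (hstep (j + 1) (hne j).1) (hstep (j + 1 + 1) (hne j).2.1) h3
  · exact hstep j hj

/-- A hole that leaves `u` or `v` inside a copy of the gadget produces a rare configuration. -/
theorem rare_of_slide (hk : 2 ≤ k) (hM : IsMatching (counterexampleGraph k) M) {j : Fin 4}
    {r s : GadgetVertex k} {x : GVertex k} (hr : gadgetHoles M j = {r})
    (hr' : r = .cyc 3 ∨ r = .cyc 9) (hs : ¬ (s = .cyc 3 ∨ s = .cyc 9)) (hx : s(x, .copy j s) ∈ M)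
    (hadj : (counterexampleGraph k).Adj x (.copy j r))
    (hs' : gadgetHoles (insert s(x, .copy j r) (M.erase s(x, .copy j s))) j = {s}) :
    ∃ c, Rare (insert s(x, .copy j r) (M.erase s(x, .copy j s))) j c := by
  have hnh : ∀ r', r' ≠ r → GVertex.copy j r' ∉ holes M := by
    intro r' hne
    rw [← mem_gadgetHoles, hr]
    simpa using hne
  obtain ⟨c₀, rfl⟩ : ∃ c, r = .cyc (pole c) := by
    rcases hr' with rfl | rfl
    exacts [⟨0, rfl⟩, ⟨1, rfl⟩]
  have hxc : ∃ c, pole c = pole c₀ ∧ x = cy j (tip c) := by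
    rcases nbr_pole hk hadj.symm with rfl | rfl | rfl
    · exact ⟨c₀, rfl, rfl⟩
    · exact ⟨c₀ + 2, by clear * -; revert c₀; decide, rfl⟩
    -- A `t` has only `u` and `v` as neighbours in a copy, so releasing `s` from a `t` contradicts
    -- `hs`.
    · rcases nbr_copy_t (hM.adj hx).symm with ⟨rfl, -⟩ | ⟨rfl, -⟩ <;> simp at hs
  obtain ⟨c, hpc, rfl⟩ := hxc
  rw [← hpc] at hr hr' hnh hadj hs' ⊢
  clear hpc c₀
  refine ⟨c, ?_⟩
  have hsm : s = .cyc (mid c) := by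
    rcases nbr_tip hk (hM.adj hx) with h | h | ⟨p, h⟩
    · exact (GVertex.copy.inj h).2
    · exfalso
      have := (GVertex.copy.inj h).2
      subst this
      exact not_mem_holes_right hx (mem_gadgetHoles.1 (by rw [hr]; simp))
    · exfalso
      rw [h] at hx
      -- If `tip c` were matched into its chain, then so would be `hub c`, and `mid c`, which is not
      -- a hole, would have no partner left.
      obtain ⟨q, hq⟩ := (hub_matched_iff_tip_matched (by omega) hM
        (fun p => hnh _ (by simp))).2 ⟨p, hx⟩
      have hmid : cy j (mid c) ∉ holes M := by
        refine hnh _ fun h => ?_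
        have := GadgetVertex.cyc.inj h
        clear * - this
        revert c; decide
      obtain ⟨y, hy⟩ := not_mem_holes.1 hmid
      rcases nbr_mid hk (hM.adj hy) with rfl | rfl
      · have := hM.right_unique (Sym2.eq_swap ▸ hy) hq
        simp at this
      · have := hM.right_unique (Sym2.eq_swap ▸ hy) hx
        simp at this
  subst hsm
  refine ⟨hs', ?_⟩
  rw [Sym2.eq_swap]
  exact Finset.mem_insert_self _ _

set_option maxHeartbeats 1000000 in
/-- A slide preserves flags, outside rare configurations. -/
theorem flag_slide (hk : 2 ≤ k) (hM : IsMatching (counterexampleGraph k) M) {j : Fin 4}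
    (hstep : SlideStep (counterexampleGraph k) M N) (hMc : (gadgetHoles M j).card ≤ 1)
    (hNc : (gadgetHoles N j).card ≤ 1) (hN : ∀ c, ¬ Rare N j c) (hf : Flag M j) : Flag N j := by
  obtain ⟨x, y, p, hxy, hp, hadj, rfl⟩ := hstep
  set N := insert s(x, p) (M.erase s(x, y)) with hNdef
  have hNm : IsMatching (counterexampleGraph k) N := hM.slide hxy hp hadj
  have hholes : holes N = insert y ((holes M).erase p) := hM.holes_slide hxy hp
  have hyM : y ∉ holes M := not_mem_holes_right hxy
  have hyN : y ∈ holes N := by rw [hholes]; exact Finset.mem_insert_self _ _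
  have hyp : y ≠ p := fun h => hyM (h ▸ hp)
  have hpN : p ∉ holes N := by rw [hholes]; simp [hyp.symm]
  have hxpN : s(x, p) ∈ N := Finset.mem_insert_self _ _
  have hsame : ∀ z, z ≠ y → z ≠ p → (z ∈ holes N ↔ z ∈ holes M) := by
    intro z h1 h2; rw [hholes]; simp [h1, h2]
  have hsing : ∀ {L : Finset (Sym2 (GVertex k))} {r}, (gadgetHoles L j).card ≤ 1 →
      .copy j r ∈ holes L → gadgetHoles L j = {r} := by
    intro L r hL hr
    rw [← mem_gadgetHoles] at hr
    obtain ⟨a, ha⟩ := Finset.card_eq_one.1 (le_antisymm hL (Finset.card_pos.2 ⟨r, hr⟩))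
    rw [ha] at hr ⊢
    rw [Finset.mem_singleton.1 hr]
  by_cases hpj : ∃ r, p = .copy j r <;> by_cases hyj : ∃ s, y = .copy j s
  · obtain ⟨r, rfl⟩ := hpj
    obtain ⟨s, rfl⟩ := hyj
    have hr := hsing hMc hp
    have hs := hsing hNc hyN
    rw [flag_of_eq_singleton hr] at hf
    rw [flag_of_eq_singleton hs]
    by_contra hcon
    obtain ⟨c, hc⟩ := rare_of_slide hk hM hr hf hcon hxy hadj hs
    exact hN c hc
  · obtain ⟨r, rfl⟩ := hpj
    have hr := hsing hMc hp
    have hemp : gadgetHoles N j = ∅ := by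
      ext r'
      simp only [Finset.notMem_empty, iff_false, mem_gadgetHoles]
      intro h
      by_cases hrr : r' = r
      · exact hpN (hrr ▸ h)
      · have := (hsame _ (fun h' => hyj ⟨r', h'.symm⟩) (by simpa using hrr)).1 h
        rw [← mem_gadgetHoles, hr] at this
        exact hrr (Finset.mem_singleton.1 this)
    rw [flag_of_eq_singleton hr] at hf
    rw [flag_of_eq_empty hemp]
    -- The moving vertex `x` is not in the copy: it would have to be `u` or `v`, as it was matched
    -- outwards, but neither is adjacent to the hole `p`, itself `u` or `v`. So `x` is a `t`.
    have hx : ∀ s, x ≠ .copy j s := by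
      rintro s rfl
      have hs : s = .cyc 3 ∨ s = .cyc 9 := by
        rcases nbr_copy (hM.adj hxy) with ⟨s', rfl, -⟩ | ⟨h, -⟩ | ⟨h, -⟩
        exacts [absurd ⟨s', rfl⟩ hyj, Or.inl h, Or.inr h]
      obtain ⟨c, rfl⟩ : ∃ c, s = .cyc (pole c) := by
        rcases hs with rfl | rfl
        exacts [⟨0, rfl⟩, ⟨1, rfl⟩]
      rcases nbr_pole hk hadj with h | h | h
      · have := (GVertex.copy.inj h).2
        rw [this] at hf
        simp only [GadgetVertex.cyc.injEq] at hf
        clear * - hf; revert c; decide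
      · have := (GVertex.copy.inj h).2
        rw [this] at hf
        simp only [GadgetVertex.cyc.injEq] at hf
        clear * - hf; revert c; decide
      · cases h
    rcases nbr_copy hadj.symm with ⟨s', rfl, -⟩ | ⟨rfl, rfl⟩ | ⟨rfl, rfl⟩
    · exact absurd rfl (hx s')
    · exact hxpN
    · rw [exit_u_iff_exit_v (by omega) hNm (gadgetHoles_eq_empty hemp)]
      exact hxpN
  · obtain ⟨s, rfl⟩ := hyj
    have hs := hsing hNc hyN
    have hemp : gadgetHoles M j = ∅ := by
      ext r'
      simp only [Finset.notMem_empty, iff_false, mem_gadgetHoles]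
      intro h
      by_cases hrr : r' = s
      · exact hyM (hrr ▸ h)
      · have := (hsame (.copy j r') (by simpa using hrr) (fun h' => hpj ⟨r', h'.symm⟩)).2 h
        rw [← mem_gadgetHoles, hs] at this
        exact hrr (Finset.mem_singleton.1 this)
    rw [flag_of_eq_empty hemp] at hf
    have hf' := (exit_u_iff_exit_v (by omega) hM (gadgetHoles_eq_empty hemp)).1 hf
    rw [flag_of_eq_singleton hs]
    rcases nbr_copy (hM.adj hxy).symm with ⟨x', rfl, -⟩ | ⟨h, -⟩ | ⟨h, -⟩
    -- If `x` were in the copy, then, being adjacent to the outside hole `p`, it would be `u` or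
    -- `v`; both are already matched to a `t`, whereas the partner of `x` is `y`.
    · exfalso
      rcases nbr_copy hadj with ⟨s', rfl, -⟩ | ⟨rfl, rfl⟩ | ⟨rfl, rfl⟩
      · exact hpj ⟨s', rfl⟩
      · have := hM.right_unique hxy (Sym2.eq_swap ▸ hf)
        cases this
      · have := hM.right_unique hxy (Sym2.eq_swap ▸ hf')
        cases this
    · exact Or.inl h
    · exact Or.inr h
  · have heq : gadgetHoles N j = gadgetHoles M j := by
      ext r
      rw [mem_gadgetHoles, mem_gadgetHoles]
      exact hsame _ (fun h => hyj ⟨r, h.symm⟩) (fun h => hpj ⟨r, h.symm⟩)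
    unfold Flag at hf ⊢
    rw [heq]
    split_ifs at hf ⊢ with h1
    · exact hf
    -- The edge from `t j` to `u` survives: removing it with the released end `y` outside the copy
    -- would mean `x = u` and `y = t j`, but then the hole `p`, a neighbour of `u` outside the copy,
    -- would also be `t j`.
    · refine Finset.mem_insert_of_mem (Finset.mem_erase.2 ⟨fun h => ?_, hf⟩)
      rcases Sym2.eq_iff.1 h with ⟨-, h2⟩ | ⟨h2, h3⟩
      · exact hyj ⟨_, h2.symm⟩
      · subst h2
        subst h3
        rcases nbr_copy hadj with ⟨s', rfl, -⟩ | ⟨-, rfl⟩ | ⟨h, -⟩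
        · exact hpj ⟨s', rfl⟩
        · exact hyp rfl
        · simp at h

/-- Adding an edge preserves flags. -/
theorem flag_add (hk : 2 ≤ k) (hM : IsMatching (counterexampleGraph k) M)
    (hc : (holes M).card ≤ 2) {j : Fin 4}
    (hstep : AddStep (counterexampleGraph k) M N) (hMc : (gadgetHoles M j).card ≤ 1) :
    Flag M j ↔ Flag N j := by
  obtain ⟨p, q, hp, hq, hadj, rfl⟩ := hstep
  set N := insert s(p, q) M with hNdef
  have hNm : IsMatching (counterexampleGraph k) N := hM.insert_edge hp hq hadj
  have hpq : holes M = {p, q} := by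
    symm
    refine Finset.eq_of_subset_of_card_le ?_ ?_
    · intro z hz
      rcases Finset.mem_insert.1 hz with rfl | hz
      · exact hp
      · rwa [Finset.mem_singleton.1 hz]
    · rw [Finset.card_pair hadj.ne]; exact hc
  have hN : holes N = ∅ := by rw [hNdef, holes_insert, hpq, Finset.sdiff_self]
  have hNe : gadgetHoles N j = ∅ := by ext r; simp [mem_gadgetHoles, hN]
  have hpqN : s(p, q) ∈ N := Finset.mem_insert_self _ _
  rw [flag_of_eq_empty hNe]
  have key : ∀ p q r, (counterexampleGraph k).Adj p q → holes M = {p, q} → s(p, q) ∈ N →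
      p = .copy j r → (Flag M j ↔ s(.t j, cy j 3) ∈ N) := by
    rintro p q r hadj hpq hpqN rfl
    have hr : gadgetHoles M j = {r} := by
      have hr : r ∈ gadgetHoles M j := by rw [mem_gadgetHoles, hpq]; simp
      obtain ⟨a, ha⟩ := Finset.card_eq_one.1 (le_antisymm hMc (Finset.card_pos.2 ⟨r, hr⟩))
      rw [ha] at hr ⊢
      rw [Finset.mem_singleton.1 hr]
    rw [flag_of_eq_singleton hr]
    rcases nbr_copy hadj with ⟨s, rfl, -⟩ | ⟨rfl, rfl⟩ | ⟨rfl, rfl⟩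
    -- The other hole cannot be in the same copy, so the new edge joins `u` or `v` to a `t` and both
    -- flags are true.
    · exfalso
      have hs : s ∈ gadgetHoles M j := by rw [mem_gadgetHoles, hpq]; simp
      rw [hr, Finset.mem_singleton] at hs
      exact hadj.ne (by rw [hs])
    · simp only [true_or, true_iff]
      rwa [Sym2.eq_swap]
    · simp only [or_true, true_iff]
      rw [exit_u_iff_exit_v (by omega) hNm (gadgetHoles_eq_empty hNe), Sym2.eq_swap]
      exact hpqN
  by_cases hpj : ∃ r, p = .copy j r
  · obtain ⟨r, hr⟩ := hpj
    exact key p q r hadj hpq hpqN hr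
  · by_cases hqj : ∃ r, q = .copy j r
    · obtain ⟨r, hr⟩ := hqj
      exact key q p r hadj.symm (by rw [hpq, Finset.pair_comm]) (by rwa [Sym2.eq_swap]) hr
    · have hMe : gadgetHoles M j = ∅ := by
        ext r
        simp only [mem_gadgetHoles, hpq, Finset.mem_insert, Finset.mem_singleton,
          Finset.notMem_empty, iff_false, not_or]
        exact ⟨fun h => hpj ⟨r, h.symm⟩, fun h => hqj ⟨r, h.symm⟩⟩
      rw [flag_of_eq_empty hMe, hNdef, Finset.mem_insert]
      constructor
      · exact Or.inr
      · rintro (h | h)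
        · rcases Sym2.eq_iff.1 h with ⟨-, h2⟩ | ⟨-, h3⟩
          · exact absurd ⟨_, h2.symm⟩ hqj
          · exact absurd ⟨_, h3.symm⟩ hpj
        · exact h

end Flags

/-! ### Moves and the number of agreeing flags -/

section Cut

variable {k : ℕ}

/-- `N` arises from `M` by a move of the Broder chain. -/
def Step (M N : State (counterexampleGraph k)) : Prop :=
  AddStep (counterexampleGraph k) M.1 N.1 ∨ AddStep (counterexampleGraph k) N.1 M.1 ∨
    SlideStep (counterexampleGraph k) M.1 N.1

theorem card_holes_le (M : State (counterexampleGraph k)) : (holes M.1).card ≤ 2 := by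
  rcases M.2.2 with h | h <;> rw [h]
  norm_num

theorem flag_iff_of_step (hk : 2 ≤ k) {M N : State (counterexampleGraph k)} (h : Step M N)
    {j : Fin 4} (hMc : (gadgetHoles M.1 j).card ≤ 1) (hNc : (gadgetHoles N.1 j).card ≤ 1)
    (hM : ∀ c, ¬ Rare M.1 j c) (hN : ∀ c, ¬ Rare N.1 j c) : Flag M.1 j ↔ Flag N.1 j := by
  rcases h with h | h | h
  · exact flag_add hk M.2.1 (card_holes_le M) h hMc
  · exact (flag_add hk N.2.1 (card_holes_le N) h hNc).symm
  -- `flag_slide` excludes rare configurations only at the target; the converse applies it to the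
  -- reversed slide.
  · exact ⟨flag_slide hk M.2.1 h hMc hNc hN, flag_slide hk N.2.1 (h.symm M.2.1) hNc hMc hM⟩

/-- A copy of the gadget containing two holes before or after a move is determined by the move. -/
theorem eq_of_card_eq_two {M N : State (counterexampleGraph k)} (h : Step M N) {i j : Fin 4}
    (hi : (gadgetHoles M.1 i).card = 2) (hj : (gadgetHoles N.1 j).card = 2) : i = j := by
  have hcM : (holes M.1).card = 2 :=
    le_antisymm (card_holes_le M) (hi.symm.le.trans (card_gadgetHoles_le i))
  have hcN : (holes N.1).card = 2 :=
    le_antisymm (card_holes_le N) (hj.symm.le.trans (card_gadgetHoles_le j))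
  have hadd : ∀ {A B : State (counterexampleGraph k)}, (holes A.1).card = 2 →
      (holes B.1).card = 2 → ¬ AddStep (counterexampleGraph k) A.1 B.1 := by
    rintro A B hA hB ⟨p, q, hp, hq, hadj, h⟩
    rw [h, holes_insert, Finset.card_sdiff_of_subset, hA, Finset.card_pair hadj.ne] at hB
    · omega
    · intro z hz
      rcases Finset.mem_insert.1 hz with rfl | hz
      · exact hp
      · rwa [Finset.mem_singleton.1 hz]
  rcases h with h | h | ⟨x, y, p, hxy, hp, hadj, h⟩
  · exact absurd h (hadd hcM hcN)
  · exact absurd h (hadd hcN hcM)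
  -- A slide leaves one of the two holes in place, and this hole lies in both copies.
  · obtain ⟨q, hq⟩ : ((holes M.1).erase p).Nonempty := by
      rw [← Finset.card_pos, Finset.card_erase_of_mem hp, hcM]; norm_num
    have hqN : q ∈ holes N.1 := by
      rw [h, M.2.1.holes_slide hxy hp]; exact Finset.mem_insert_of_mem hq
    obtain ⟨r, hr⟩ := exists_eq_copy_of_card_eq_two hcM.le hi (Finset.mem_of_mem_erase hq)
    obtain ⟨s, hs⟩ := exists_eq_copy_of_card_eq_two hcN.le hj hqN
    rw [hr] at hs
    exact (GVertex.copy.inj hs).1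

open Classical in
/-- The copies of the gadget whose flag is as in a perfect matching in which `u` and `v` are matched
to the outside in the copies with even index. -/
def agree (M : State (counterexampleGraph k)) : Finset (Fin 4) :=
  Finset.univ.filter fun j => Flag M.1 j ↔ Even (j : ℕ)

theorem mem_agree {M : State (counterexampleGraph k)} {j : Fin 4} :
    j ∈ agree M ↔ (Flag M.1 j ↔ Even (j : ℕ)) := by simp [agree]

/-- Alternating flags agree everywhere or nowhere. -/
theorem agree_of_alternate {M : State (counterexampleGraph k)}
    (h : ∀ j, Flag M.1 (j + 1) ↔ ¬ Flag M.1 j) : agree M = Finset.univ ∨ agree M = ∅ := by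
  -- The number of copies is even, so index parity also alternates from the last copy to the first.
  have e : ∀ j : Fin 4, Even ((j + 1 : Fin 4) : ℕ) ↔ ¬ Even (j : ℕ) := by decide
  have h0 : ∀ i j : Fin 4, i = j + 1 → (i ∈ agree M ↔ j ∈ agree M) := by
    rintro i j rfl
    rw [mem_agree, mem_agree, h, e, not_iff_not]
  have hall : ∀ j, j ∈ agree M ↔ 0 ∈ agree M := by
    have hj : ∀ j : Fin 4, j = 0 ∨ j = 1 ∨ j = 2 ∨ j = 3 := by decide
    have h1 := h0 1 0 rfl
    have h2 := h0 2 1 rfl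
    have h3 := h0 3 2 rfl
    intro j
    rcases hj j with rfl | rfl | rfl | rfl
    exacts [Iff.rfl, h1, h2.trans h1, h3.trans (h2.trans h1)]
  by_cases h4 : (0 : Fin 4) ∈ agree M
  · exact Or.inl (Finset.eq_univ_of_forall fun j => (hall j).2 h4)
  · exact Or.inr (Finset.eq_empty_of_forall_notMem fun j hj => h4 ((hall j).1 hj))

theorem agree_of_card_eq_two (hk : 1 ≤ k) {M : State (counterexampleGraph k)} {j : Fin 4}
    (h : (gadgetHoles M.1 j).card = 2) : agree M = Finset.univ ∨ agree M = ∅ :=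
  agree_of_alternate (flag_alternate hk M.2.1
    (fun _ hx => exists_eq_copy_of_card_eq_two (card_holes_le M) h hx) (by rw [h]; norm_num))

theorem agree_of_perfect (hk : 1 ≤ k) {M : State (counterexampleGraph k)} (h : holes M.1 = ∅) :
    agree M = Finset.univ ∨ agree M = ∅ := by
  refine agree_of_alternate (flag_alternate (j₀ := 0) hk M.2.1 (by rw [h]; simp) ?_)
  have : gadgetHoles M.1 0 = ∅ := by ext r; simp [mem_gadgetHoles, h]
  rw [this]; simp

/-- Outside rare configurations, no move crosses the cut. -/
theorem no_crossing (hk : 2 ≤ k) {M N : State (counterexampleGraph k)} (h : Step M N)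
    (hM : ∀ j c, ¬ Rare M.1 j c) (hN : ∀ j c, ¬ Rare N.1 j c) (h3 : 3 ≤ (agree M).card) :
    3 ≤ (agree N).card := by
  have hcard : ∀ (L : State (counterexampleGraph k)) (j : Fin 4), (gadgetHoles L.1 j).card ≠ 2 →
      (gadgetHoles L.1 j).card ≤ 1 := by
    intro L j hL
    have := (card_gadgetHoles_le (M := L.1) j).trans (card_holes_le L)
    omega
  have hmem : ∀ j, (gadgetHoles M.1 j).card ≠ 2 → (gadgetHoles N.1 j).card ≠ 2 →
      (j ∈ agree M ↔ j ∈ agree N) := by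
    intro j h1 h2
    rw [mem_agree, mem_agree, flag_iff_of_step hk h (hcard M j h1) (hcard N j h2) (hM j) (hN j)]
  have huniq : ∀ (L : State (counterexampleGraph k)) {i j : Fin 4},
      (gadgetHoles L.1 i).card = 2 → (gadgetHoles L.1 j).card = 2 → i = j := by
    intro L i j hi hj
    have hpos : 0 < (gadgetHoles L.1 j).card := by omega
    obtain ⟨r, hr⟩ := Finset.card_pos.1 hpos
    obtain ⟨s, hs⟩ := exists_eq_copy_of_card_eq_two (card_holes_le L) hi (mem_gadgetHoles.1 hr)
    exact (GVertex.copy.inj hs).1.symm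
  have herase : ∀ {A B : Finset (Fin 4)} {j : Fin 4}, (∀ i, i ≠ j → (i ∈ A ↔ i ∈ B)) →
      A.card ≤ B.card + 1 := by
    intro A B j hAB
    have : A ⊆ insert j B := by
      intro i hi
      by_cases hij : i = j
      · simp [hij]
      · exact Finset.mem_insert_of_mem ((hAB i hij).1 hi)
    exact (Finset.card_le_card this).trans (Finset.card_insert_le _ _)
  -- At most one copy `j` has two holes before or after the move. Only its flag is uncontrolled, and
  -- at the end of the move with both holes in it the count is 4 or 0, so the other count is at
  -- least 3 or at most 1.
  by_cases hb : ∃ j, (gadgetHoles M.1 j).card = 2 ∨ (gadgetHoles N.1 j).card = 2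
  · obtain ⟨j, hj⟩ := hb
    have hoff : ∀ i, i ≠ j → (i ∈ agree M ↔ i ∈ agree N) := by
      intro i hi
      refine hmem i (fun h1 => hi ?_) fun h1 => hi ?_
      · rcases hj with hj | hj
        exacts [huniq M h1 hj, eq_of_card_eq_two h h1 hj]
      · rcases hj with hj | hj
        exacts [(eq_of_card_eq_two h hj h1).symm, huniq N h1 hj]
    rcases hj with hj | hj
    · have h4 : (agree M).card = 4 := by
        rcases agree_of_card_eq_two (by omega) hj with h' | h'
        · rw [h']; simp
        · rw [h'] at h3; simp at h3
      have := herase hoff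
      omega
    · rcases agree_of_card_eq_two (by omega) hj with h' | h'
      · rw [h']; simp
      · have := herase hoff
        rw [h'] at this
        simp at this
        omega
  · push Not at hb
    have : agree M = agree N := by
      ext j
      exact hmem j (hb j).1 (hb j).2
    rwa [← this]

end Cut

/-! ### Matchings of a chain of boxes -/

section BoxMatchings

variable {k : ℕ}

/-- The matching of the inner vertices of a chain of boxes, as an involution fixing the ends. -/
def off : BoxVertex k → BoxVertex k
  -- Truncated subtraction makes `v 0` a fixed point.
  | .v i => if (i : ℕ) % 2 = 0 then .v ⟨i - 1, by omega⟩
      else if h : (i : ℕ) + 1 < 2 * k then .v ⟨i + 1, h⟩ else .v i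
  | .a i => .b i
  | .b i => .a i

theorem off_off (p : BoxVertex k) : off (off p) = p := by
  rcases p with ⟨i, hi⟩ | i | i
  · simp only [off]
    split_ifs with h1 h2
    · rcases Nat.eq_zero_or_pos i with rfl | h0
      · simp
      · simp only
        rw [if_neg (by omega), dif_pos (by omega)]
        simp only [BoxVertex.v.injEq, Fin.mk.injEq]
        omega
    · simp only
      rw [if_pos (by omega)]
      simp
    · simp only
      rw [if_neg h1, dif_neg h2]
  · rfl
  · rfl

theorem isEnd_off {p : BoxVertex k} (hp : ¬ p.IsEnd) : ¬ (off p).IsEnd := by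
  rcases p with ⟨i, hi⟩ | i | i
  · simp only [BoxVertex.isEnd_v] at hp
    simp only [off]
    split_ifs with h1 h2
    · simp only [BoxVertex.isEnd_v]; omega
    · simp only [BoxVertex.isEnd_v]; omega
    · omega
  · exact fun h => h
  · exact fun h => h

theorem adj_off {p : BoxVertex k} (hp : ¬ p.IsEnd) : (boxChain k).Adj p (off p) := by
  rw [boxChain_adj]
  rcases p with ⟨i, hi⟩ | i | i
  · simp only [BoxVertex.isEnd_v] at hp
    simp only [off]
    split_ifs with h1 h2
    · right; simp only [BoxRel]; omega
    · left; simp only [BoxRel]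
    · omega
  · left; simp [off, BoxRel]
  · right; simp [off, BoxRel]

/-- The perfect matchings of a chain of boxes, as involutions. -/
def on (s : Fin k → Bool) : BoxVertex k → BoxVertex k
  | .v i => if s ⟨i / 2, by omega⟩ then
        (if (i : ℕ) % 2 = 0 then .v ⟨2 * (i / 2) + 1, by omega⟩ else .v ⟨2 * (i / 2), by omega⟩)
      else (if (i : ℕ) % 2 = 0 then .a ⟨i / 2, by omega⟩ else .b ⟨i / 2, by omega⟩)
  | .a i => if s i then .b i else .v ⟨2 * i, by omega⟩
  | .b i => if s i then .a i else .v ⟨2 * i + 1, by omega⟩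

theorem on_on (s : Fin k → Bool) (p : BoxVertex k) : on s (on s p) = p := by
  have e1 : ∀ i : ℕ, (2 * i + 1) / 2 = i := by omega
  have e2 : ∀ i : ℕ, 2 * i / 2 = i := by omega
  rcases p with ⟨i, hi⟩ | i | i
  · simp only [on]
    split_ifs with h1 h2 h2
    · simp only [e1, h1, if_true]
      rw [if_neg (by omega)]
      simp only [BoxVertex.v.injEq, Fin.mk.injEq]
      omega
    · simp only [e2, h1, if_true]
      rw [if_pos (by omega)]
      simp only [BoxVertex.v.injEq, Fin.mk.injEq]
      omega
    · simp only [if_neg h1, BoxVertex.v.injEq, Fin.mk.injEq]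
      omega
    · simp only [if_neg h1, BoxVertex.v.injEq, Fin.mk.injEq]
      omega
  · simp only [on]
    split_ifs with h1
    · simp only [h1, if_true]
    · simp only [e2, if_neg h1]
      rw [if_pos (by omega)]
  · simp only [on]
    split_ifs with h1
    · simp only [h1, if_true]
    · simp only [e1, if_neg h1]
      rw [if_neg (by omega)]

theorem adj_on (s : Fin k → Bool) (p : BoxVertex k) : (boxChain k).Adj p (on s p) := by
  rw [boxChain_adj]
  rcases p with ⟨i, hi⟩ | i | i
  · simp only [on]
    split_ifs with h1 h2 h2
    · left; simp only [BoxRel]; omega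
    · right; simp only [BoxRel]; omega
    · left; simp only [BoxRel]; omega
    · right; simp only [BoxRel]; omega
  · simp only [on]
    split_ifs with h1
    · left; simp [BoxRel]
    · right; simp [BoxRel]
  · simp only [on]
    split_ifs with h1
    · right; simp [BoxRel]
    · left; simp [BoxRel]

/-- Each box is a four-cycle with two perfect matchings, told apart by the partner of `a i`. -/
theorem on_injective {s s' : Fin k → Bool} (h : ∀ i, on s (.a i) = on s' (.a i)) : s = s' := by
  funext i
  have := h i
  simp only [on] at this
  cases h1 : s i <;> cases h2 : s' i <;> simp [h1, h2] at this ⊢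

/-- If the inner vertices of a chain of boxes are matched among themselves, this is by `off`. -/
theorem off_forced {R : BoxVertex k → BoxVertex k → Prop} (hsymm : ∀ p q, R p q → R q p)
    (huniq : ∀ p q q', R p q → R p q' → q = q')
    (hex : ∀ p, ¬ p.IsEnd → ∃ q, (boxChain k).Adj p q ∧ R p q)
    (hend : ∀ p q, p.IsEnd → ¬ q.IsEnd → ¬ R p q) (p : BoxVertex k) (hp : ¬ p.IsEnd) :
    R p (off p) := by
  -- The matching is forced from left to right: once `v (2i)` is an end or matched backwards, `a i`
  -- must take `b i`, and then `v (2i+1)`, unless it is an end, can only be matched forwards.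
  have hback : ∀ (i : ℕ) (hi : i < k) (q : BoxVertex k), ¬ q.IsEnd →
      (∀ h : 1 ≤ i, q ≠ .v ⟨2 * i - 1, by omega⟩) →
      (∀ h : 1 ≤ i, R (.v ⟨2 * i - 1, by omega⟩) (.v ⟨2 * i, by omega⟩)) →
      ¬ R q (.v ⟨2 * i, by omega⟩) := by
    intro i hi q hq hne hR h
    rcases Nat.eq_zero_or_pos i with rfl | h0
    · exact hend _ _ (BoxVertex.isEnd_v.2 (Or.inl rfl)) hq (hsymm _ _ h)
    · exact hne h0 (huniq _ _ _ (hsymm _ _ h) (hsymm _ _ (hR h0)))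
  have hab' : ∀ (i : ℕ) (hi : i < k),
      (∀ h : 1 ≤ i, R (.v ⟨2 * i - 1, by omega⟩) (.v ⟨2 * i, by omega⟩)) →
      R (.a ⟨i, hi⟩) (.b ⟨i, hi⟩) := by
    intro i hi hR
    obtain ⟨q, hadj, hq⟩ := hex (.a ⟨i, hi⟩) BoxVertex.not_isEnd_a
    rw [boxChain_adj] at hadj
    rcases q with ⟨l, hl⟩ | l | l
    · simp only [BoxRel, false_or] at hadj
      subst hadj
      exact absurd hq (hback i hi _ BoxVertex.not_isEnd_a (by simp) hR)
    · simp [BoxRel] at hadj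
    · simp only [BoxRel, or_false] at hadj
      rwa [← hadj] at hq
  have hvv' : ∀ (i : ℕ) (hi : i + 1 < k),
      (∀ h : 1 ≤ i, R (.v ⟨2 * i - 1, by omega⟩) (.v ⟨2 * i, by omega⟩)) →
      R (.v ⟨2 * i + 1, by omega⟩) (.v ⟨2 * i + 2, by omega⟩) := by
    intro i hi hR
    have hne : ¬ (BoxVertex.v (k := k) ⟨2 * i + 1, by omega⟩).IsEnd := by
      simp only [BoxVertex.isEnd_v]; omega
    obtain ⟨q, hadj, hq⟩ := hex _ hne
    rw [boxChain_adj] at hadj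
    rcases q with ⟨l, hl⟩ | ⟨l, hl⟩ | ⟨l, hl⟩
    · simp only [BoxRel] at hadj
      rcases hadj with rfl | hadj
      · exact hq
      · obtain rfl : l = 2 * i := by omega
        refine absurd hq (hback i (by omega) _ hne (fun h => ?_) hR)
        simp only [ne_eq, BoxVertex.v.injEq, Fin.mk.injEq]
        omega
    · simp only [BoxRel, or_false] at hadj
      omega
    · simp only [BoxRel, false_or] at hadj
      obtain rfl : l = i := by omega
      have := huniq _ _ _ (hsymm _ _ hq) (hsymm _ _ (hab' l hl hR))
      cases this
  have hvv : ∀ (i : ℕ) (hi : i + 1 < k),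
      R (.v ⟨2 * i + 1, by omega⟩) (.v ⟨2 * i + 2, by omega⟩) := by
    intro i
    induction i with
    | zero => exact fun hi => hvv' 0 hi fun h => by omega
    | succ i ih => exact fun hi => hvv' (i + 1) hi fun h => ih (by omega)
  have hab : ∀ (i : Fin k), R (.a i) (.b i) := by
    rintro ⟨i, hi⟩
    refine hab' i hi fun h => ?_
    have := hvv (i - 1) (by omega)
    convert this using 3 <;> omega
  rcases p with ⟨i, hi⟩ | i | i
  · simp only [BoxVertex.isEnd_v] at hp
    simp only [off]
    split_ifs with h1 h2
    · apply hsymm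
      have := hvv (i / 2 - 1) (by omega)
      convert this using 3 <;> omega
    · have := hvv (i / 2) (by omega)
      convert this using 3 <;> omega
    · omega
  · exact hab i
  · exact hsymm _ _ (hab i)

end BoxMatchings

/-! ### Rare configurations are rare -/

section Switch

variable {V : Type*} [Fintype V] [DecidableEq V] {G : SimpleGraph V} {M D A : Finset (Sym2 V)}

/-- The image under `χ` of the matching of `X` given by the involution `f`. -/
def involutionMatching {W : Type*} (χ : W → V) (X : Finset W) (f : W → W) : Finset (Sym2 V) :=
  X.image fun p => s(χ p, χ (f p))

theorem isMatching_involutionMatching {W : Type*} {χ : W → V} (hχ : Function.Injective χ)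
    {X : Finset W} {f : W → W} (hf : ∀ p ∈ X, f (f p) = p)
    (hadj : ∀ p ∈ X, G.Adj (χ p) (χ (f p))) : IsMatching G (involutionMatching χ X f) := by
  constructor
  · intro e he
    obtain ⟨p, hp, rfl⟩ := Finset.mem_image.1 he
    exact hadj p hp
  · intro e he e' he' v hv hv'
    obtain ⟨p, hp, rfl⟩ := Finset.mem_image.1 he
    obtain ⟨q, hq, rfl⟩ := Finset.mem_image.1 he'
    rcases Sym2.mem_iff.1 hv with rfl | rfl <;> rcases Sym2.mem_iff.1 hv' with h | h <;>
      have h := hχ h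
    · rw [h]
    · rw [h, hf q hq, Sym2.eq_swap]
    · rw [← h, hf p hp, Sym2.eq_swap]
    · rw [← hf p hp, h, hf q hq]

theorem mem_holes_involutionMatching {W : Type*} {χ : W → V} {X : Finset W} {f : W → W}
    (hfX : ∀ p ∈ X, f p ∈ X) {v : V} :
    v ∈ holes (involutionMatching χ X f) ↔ ∀ p ∈ X, v ≠ χ p := by
  rw [mem_holes]
  constructor
  · rintro h p hp rfl
    exact h _ (Finset.mem_image_of_mem _ hp) (Sym2.mem_mk_left _ _)
  · intro h e he hv
    obtain ⟨p, hp, rfl⟩ := Finset.mem_image.1 he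
    rcases Sym2.mem_iff.1 hv with rfl | rfl
    exacts [h p hp rfl, h _ (hfX p hp) rfl]

theorem IsMatching.mem_holes_sdiff (hM : IsMatching G M) (hD : D ⊆ M) {v : V}
    (hv : v ∉ holes D) : v ∈ holes (M \ D) := by
  obtain ⟨y, hy⟩ := not_mem_holes.1 hv
  rw [mem_holes]
  intro e he hve
  obtain ⟨he, heD⟩ := Finset.mem_sdiff.1 he
  exact heD (hM.2 _ he _ (hD hy) v hve (Sym2.mem_mk_left _ _) ▸ hy)

/-- Replacing a part of a matching by another matching of the same vertices. -/
theorem IsMatching.switch (hM : IsMatching G M) (hD : D ⊆ M) (hA : IsMatching G A)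
    (hDA : holes A = holes D) : IsMatching G (M \ D ∪ A) := by
  have key : ∀ e ∈ M \ D, ∀ f ∈ A, ∀ v, v ∈ e → v ∉ f := by
    intro e he f hf v hve hvf
    have : v ∉ holes D := by rw [← hDA, mem_holes]; exact fun h => h f hf hvf
    exact mem_holes.1 (hM.mem_holes_sdiff hD this) e he hve
  constructor
  · intro e he
    rcases Finset.mem_union.1 he with he | he
    exacts [hM.1 e (Finset.mem_sdiff.1 he).1, hA.1 e he]
  · intro e he f hf v hve hvf
    rcases Finset.mem_union.1 he with he | he <;> rcases Finset.mem_union.1 hf with hf | hf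
    · exact hM.2 e (Finset.mem_sdiff.1 he).1 f (Finset.mem_sdiff.1 hf).1 v hve hvf
    · exact absurd hvf (key e he f hf v hve)
    · exact absurd hve (key f hf e he v hvf)
    · exact hA.2 e he f hf v hve hvf

theorem IsMatching.holes_switch (hD : D ⊆ M) (hDA : holes A = holes D) :
    holes (M \ D ∪ A) = holes M := by
  have hu : ∀ A B : Finset (Sym2 V), holes (A ∪ B) = holes A ∩ holes B := by
    intro A B; ext v
    simp only [mem_holes, Finset.mem_inter, Finset.mem_union, or_imp, forall_and]
  rw [hu, hDA, ← hu, Finset.sdiff_union_of_subset hD]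

/-- The inserted part `A` is disjoint from what remains of `M`, so the exchange can be undone once
`A` is known; this is what makes the encoding of rare states injective. -/
theorem IsMatching.switch_back (hM : IsMatching G M) (hD : D ⊆ M) (hDA : holes A = holes D) :
    (M \ D ∪ A) \ A ∪ D = M := by
  have : Disjoint (M \ D) A := by
    rw [Finset.disjoint_left]
    intro e he heA
    induction e with
    | _ x y =>
      have hx : x ∉ holes D := by rw [← hDA]; exact not_mem_holes_left heA
      exact not_mem_holes_left he (hM.mem_holes_sdiff hD hx)
  rw [Finset.union_sdiff_cancel_right this, Finset.sdiff_union_of_subset hD]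

end Switch

/-- If `Φ` maps `R × T` injectively into the state space and preserves the weight, then the weight
of `R` is at most the total weight divided by the size of `T`. -/
theorem card_mul_sum_le {S T : Type*} [Fintype S] [DecidableEq S] [Fintype T] {R : Finset S}
    {Φ : S → T → S} {w : S → ℝ} (hw : ∀ M, 0 ≤ w M) (hΦ : ∀ M ∈ R, ∀ s, w (Φ M s) = w M)
    (hinj : ∀ M ∈ R, ∀ N ∈ R, ∀ s s', Φ M s = Φ N s' → M = N ∧ s = s') :
    Fintype.card T * ∑ M ∈ R, w M ≤ ∑ M, w M := by
  have hinj' : Set.InjOn (fun q : S × T => Φ q.1 q.2) ↑(R ×ˢ (Finset.univ : Finset T)) := by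
    intro q hq q' hq' h
    have h1 := (Finset.mem_product.1 (Finset.mem_coe.1 hq)).1
    have h2 := (Finset.mem_product.1 (Finset.mem_coe.1 hq')).1
    obtain ⟨h3, h4⟩ := hinj q.1 h1 q'.1 h2 q.2 q'.2 h
    exact Prod.ext h3 h4
  calc Fintype.card T * ∑ M ∈ R, w M
      = ∑ q ∈ R ×ˢ (Finset.univ : Finset T), w (Φ q.1 q.2) := by
        rw [Finset.sum_product, Finset.mul_sum]
        refine Finset.sum_congr rfl fun M hM => ?_
        rw [Finset.sum_congr rfl fun s _ => hΦ M hM s]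
        simp
    _ = ∑ N ∈ (R ×ˢ (Finset.univ : Finset T)).image (fun q => Φ q.1 q.2), w N :=
        (Finset.sum_image hinj').symm
    _ ≤ ∑ M, w M := Finset.sum_le_sum_of_subset_of_nonneg (Finset.subset_univ _)
        fun M _ _ => hw M

/-! ### The exchange in a rare configuration -/

section RareConfigurations

variable {k : ℕ} {M : Finset (Sym2 (GVertex k))}

/-- The vertex of the graph that the vertex `p` of the `c`-th chain of boxes in the `j`-th copy of
the gadget becomes. -/
def chi (k : ℕ) (j c : Fin 4) (p : BoxVertex k) : GVertex k := .copy j (chainMap k c p)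

theorem chi_injective (j c : Fin 4) : Function.Injective (chi k j c) :=
  fun _ _ h => chainMap_injective c (GVertex.copy.inj h).2

theorem chi_of_not_isEnd (j c : Fin 4) {p : BoxVertex k} (hp : ¬ p.IsEnd) :
    chi k j c p = inn j c ⟨p, hp⟩ := by rw [chi, chainMap_of_not_isEnd c hp]

theorem chi_adj (j c : Fin 4) {p q : BoxVertex k} (h : (boxChain k).Adj p q) :
    (counterexampleGraph k).Adj (chi k j c p) (chi k j c q) :=
  adj_copy_copy.2 ⟨rfl, gadget_adj_chainMap c h⟩

theorem exists_chi_eq_hub (hk : 1 ≤ k) (j c : Fin 4) :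
    ∃ p : BoxVertex k, p.IsEnd ∧ chi k j c p = cy j (hub c) := by
  have h0 := chainMap_start (k := k) c (i := ⟨0, by omega⟩) rfl
  have h1 := chainMap_end (k := k) c (i := ⟨2 * k - 1, by omega⟩) (by simp only; omega)
  have : chainStart c = hub c ∨ chainEnd c = hub c := by clear * -; revert c; decide
  rcases this with h | h
  · exact ⟨_, BoxVertex.isEnd_v.2 (Or.inl rfl), by rw [chi, h0, h]⟩
  · exact ⟨.v ⟨2 * k - 1, by omega⟩, BoxVertex.isEnd_v.2 (Or.inr (by simp only; omega)),
      by rw [chi, h1, h]⟩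

theorem exists_chi_eq_tip (hk : 1 ≤ k) (j c : Fin 4) :
    ∃ p : BoxVertex k, p.IsEnd ∧ chi k j c p = cy j (tip c) := by
  have h0 := chainMap_start (k := k) c (i := ⟨0, by omega⟩) rfl
  have h1 := chainMap_end (k := k) c (i := ⟨2 * k - 1, by omega⟩) (by simp only; omega)
  have : chainStart c = tip c ∨ chainEnd c = tip c := by clear * -; revert c; decide
  rcases this with h | h
  · exact ⟨_, BoxVertex.isEnd_v.2 (Or.inl rfl), by rw [chi, h0, h]⟩
  · exact ⟨.v ⟨2 * k - 1, by omega⟩, BoxVertex.isEnd_v.2 (Or.inr (by simp only; omega)),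
      by rw [chi, h1, h]⟩

theorem chi_isEnd (j c : Fin 4) {p : BoxVertex k} (hp : p.IsEnd) :
    chi k j c p = cy j (hub c) ∨ chi k j c p = cy j (tip c) := by
  rcases chainMap_isEnd c hp with h | h <;> simp [chi, h]

/-- The part of a rare configuration that is exchanged. -/
def rarePart (k : ℕ) (j c : Fin 4) : Finset (Sym2 (GVertex k)) :=
  insert s(cy j (pole c), cy j (tip c)) (insert s(cy j (mid (c + 2)), cy j (tip (c + 2)))
    (insert s(cy j (hub c), cy j (hub (c + 2)))
      (involutionMatching (chi k j c) (Finset.univ.filter fun p => ¬ p.IsEnd) off)))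

/-- The matchings by which `rarePart` is replaced. -/
def commonPart (k : ℕ) (j c : Fin 4) (s : Fin k → Bool) : Finset (Sym2 (GVertex k)) :=
  insert s(cy j (pole c), cy j (tip (c + 2))) (insert s(cy j (mid (c + 2)), cy j (hub (c + 2)))
    (involutionMatching (chi k j c) Finset.univ (on s)))

/-- Both parts cover exactly `pole c`, the tips and hubs of the chains `c` and `c + 2`, `mid (c +
2)` and the inner vertices of the chain `c`. -/
theorem holes_commonPart (hk : 1 ≤ k) (j c : Fin 4) (s : Fin k → Bool) :
    holes (commonPart k j c s) = holes (rarePart k j c) := by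
  have h : ∀ v : GVertex k, (∀ p ∈ Finset.univ, v ≠ chi k j c p) ↔
      (∀ p ∈ Finset.univ.filter fun p : BoxVertex k => ¬ p.IsEnd, v ≠ chi k j c p) ∧
        v ≠ cy j (hub c) ∧ v ≠ cy j (tip c) := by
    intro v
    constructor
    · intro h
      refine ⟨fun p _ => h p (Finset.mem_univ _), ?_, ?_⟩
      · obtain ⟨p, -, hp⟩ := exists_chi_eq_hub hk j c
        rw [← hp]; exact h p (Finset.mem_univ _)
      · obtain ⟨p, -, hp⟩ := exists_chi_eq_tip hk j c
        rw [← hp]; exact h p (Finset.mem_univ _)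
    · rintro ⟨h1, h2, h3⟩ p -
      by_cases hp : p.IsEnd
      · rcases chi_isEnd j c hp with h' | h' <;> rw [h'] <;> assumption
      · exact h1 p (Finset.mem_filter.2 ⟨Finset.mem_univ _, hp⟩)
  ext v
  simp only [commonPart, rarePart, holes_insert, Finset.mem_sdiff, Finset.mem_insert,
    Finset.mem_singleton]
  rw [mem_holes_involutionMatching (fun p _ => Finset.mem_univ _),
    mem_holes_involutionMatching (fun p hp => ?_), h]
  · tauto
  · rw [Finset.mem_filter] at hp ⊢
    exact ⟨Finset.mem_univ _, isEnd_off hp.2⟩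

theorem isMatching_commonPart (j c : Fin 4) (s : Fin k → Bool) :
    IsMatching (counterexampleGraph k) (commonPart k j c s) := by
  have hu : ∀ p ∈ (Finset.univ : Finset (BoxVertex k)), on s p ∈ Finset.univ :=
    fun p _ => Finset.mem_univ _
  have hne : ∀ m : Fin 12, m ≠ hub c → m ≠ tip c →
      cy j m ∈ holes (involutionMatching (chi k j c) Finset.univ (on s)) := by
    intro m h1 h2
    rw [mem_holes_involutionMatching hu]
    intro p _ h
    by_cases hp : p.IsEnd
    · rcases chi_isEnd j c hp with h' | h' <;> rw [h'] at h <;> simp at h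
      exacts [h1 h, h2 h]
    · rw [chi_of_not_isEnd j c hp] at h; simp at h
  have d : (mid (c + 2) ≠ hub c ∧ mid (c + 2) ≠ tip c) ∧
      (hub (c + 2) ≠ hub c ∧ hub (c + 2) ≠ tip c) ∧ (pole c ≠ hub c ∧ pole c ≠ tip c) ∧
      (tip (c + 2) ≠ hub c ∧ tip (c + 2) ≠ tip c) ∧
      (pole c ≠ mid (c + 2) ∧ pole c ≠ hub (c + 2)) ∧
      (tip (c + 2) ≠ mid (c + 2) ∧ tip (c + 2) ≠ hub (c + 2)) ∧
      CycAdj (mid (c + 2)) (hub (c + 2)) ∧ CycAdj (pole c) (tip (c + 2)) := by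
    clear * -; revert c; decide
  obtain ⟨d1, d2, d3, d4, d5, d6, d7, d8⟩ := d
  have m0 := isMatching_involutionMatching (G := counterexampleGraph k) (chi_injective j c)
    (fun p _ => on_on s p) (fun p (_ : p ∈ Finset.univ) => chi_adj j c (adj_on s p))
  have m1 := m0.insert_edge (hne _ d1.1 d1.2) (hne _ d2.1 d2.2)
    (adj_copy_copy.2 ⟨rfl, gadget_adj_cyc d7⟩)
  refine m1.insert_edge ?_ ?_ (adj_copy_copy.2 ⟨rfl, gadget_adj_cyc d8⟩)
  · rw [holes_insert, Finset.mem_sdiff]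
    exact ⟨hne _ d3.1 d3.2, by simp [d5]⟩
  · rw [holes_insert, Finset.mem_sdiff]
    exact ⟨hne _ d4.1 d4.2, by simp [d6]⟩

/-- The matching is determined by `Rare` on the part that is exchanged. -/
theorem rarePart_subset (hk : 2 ≤ k) (hM : IsMatching (counterexampleGraph k) M) {j c : Fin 4}
    (h : Rare M j c) : rarePart k j c ⊆ M := by
  obtain ⟨hh, hpt⟩ := h
  have hnh : ∀ r, r ≠ .cyc (mid c) → GVertex.copy j r ∉ holes M := by
    intro r hne
    rw [← mem_gadgetHoles, hh]
    simpa using hne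
  have hmid : cy j (mid c) ∈ holes M := by rw [← mem_gadgetHoles, hh]; simp
  have hcyc : ∀ m, m ≠ mid c → cy j m ∉ holes M := fun m hm => hnh _ (by simpa using hm)
  have hinn : ∀ (c' : Fin 4) p, inn j c' p ∉ holes M := fun c' p => hnh _ (by simp)
  have hchain : ∀ c', (∃ p, s(cy j (hub c'), inn j c' p) ∈ M) ↔
      ∃ p, s(cy j (tip c'), inn j c' p) ∈ M :=
    fun c' => hub_matched_iff_tip_matched (by omega) hM (hinn c')
  have d : mid (c + 2) ≠ mid c ∧ tip (c + 2) ≠ mid c ∧ mid (twin c) ≠ mid c ∧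
      tip (twin c) ≠ mid c ∧ hub c ≠ mid c ∧ pole (c + 2) = pole c ∧ hub (twin c) = hub c ∧
      tip (c + 2) ≠ tip c ∧ mid (twin c) ≠ tip (twin c) ∧
      (∀ c₁, pole c₁ ≠ pole c → pole c₁ = pole (twin c)) := by
    clear * -; revert c; decide
  obtain ⟨d1, d2, d3, d4, d5, d6, d7, d8, d9, d10⟩ := d
  have htipc : ¬ ∃ p, s(cy j (tip c), inn j c p) ∈ M := by
    rintro ⟨p, hp⟩
    have := hM.right_unique hp (Sym2.eq_swap ▸ hpt)
    simp at this
  have hhubc : ¬ ∃ p, s(cy j (hub c), inn j c p) ∈ M := fun h => htipc ((hchain c).1 h)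
  -- the other pole is matched to the outside
  have hexit : s(cy j (tip (twin c)), cy j (pole (twin c))) ∉ M := by
    obtain ⟨c₁, hc₁⟩ : ∃ c₁, s(.t (poleT j c₁), cy j (pole c₁)) ∈ M := by
      rcases exit_of_odd (by omega) hM hnh (fun r hr => not_mem_holes_right hr hmid) with
        ⟨-, h⟩ | ⟨-, h⟩
      exacts [⟨0, h⟩, ⟨1, h⟩]
    have hne : pole c₁ ≠ pole c := by
      intro h
      rw [h] at hc₁
      have := hM.right_unique hpt (Sym2.eq_swap ▸ hc₁)
      simp at this
    rw [d10 c₁ hne] at hc₁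
    intro h
    have := hM.right_unique (Sym2.eq_swap ▸ h) (Sym2.eq_swap ▸ hc₁)
    simp at this
  -- Were `mid (c + 2)` matched to its hub, `tip (c + 2)` would be stuck: the common pole is taken
  -- by `tip c`, and entering the chain would require the hub to enter it too.
  have h1 : s(cy j (mid (c + 2)), cy j (tip (c + 2))) ∈ M := by
    obtain ⟨y, hy⟩ := not_mem_holes.1 (hcyc _ d1)
    rcases nbr_mid hk (hM.adj hy) with rfl | rfl
    · exfalso
      obtain ⟨z, hz⟩ := not_mem_holes.1 (hcyc _ d2)
      rcases nbr_tip hk (hM.adj hz) with rfl | rfl | ⟨p, rfl⟩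
      · have := hM.right_unique hy (Sym2.eq_swap ▸ hz)
        simp only [cy, GVertex.copy.injEq, GadgetVertex.cyc.injEq, true_and] at this
        clear * - this; revert c; decide
      · rw [d6] at hz
        have := hM.right_unique hpt (Sym2.eq_swap ▸ hz)
        simp only [cy, GVertex.copy.injEq, GadgetVertex.cyc.injEq, true_and] at this
        exact d8 this.symm
      · obtain ⟨q, hq⟩ := (hchain _).2 ⟨p, hz⟩
        have := hM.right_unique hq (Sym2.eq_swap ▸ hy)
        simp at this
    · exact hy
  -- The twin's pole is matched outside. If the twin's tip entered its chain, so would the hub,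
  -- leaving `mid (twin c)` without a partner.
  have h2 : s(cy j (mid (twin c)), cy j (tip (twin c))) ∈ M := by
    obtain ⟨z, hz⟩ := not_mem_holes.1 (hcyc _ d4)
    rcases nbr_tip hk (hM.adj hz) with rfl | rfl | ⟨p, rfl⟩
    · exact Sym2.eq_swap ▸ hz
    · exact absurd hz hexit
    · exfalso
      obtain ⟨q, hq⟩ := (hchain _).2 ⟨p, hz⟩
      obtain ⟨y, hy⟩ := not_mem_holes.1 (hcyc _ d3)
      rcases nbr_mid hk (hM.adj hy) with rfl | rfl
      · have := hM.right_unique hq (Sym2.eq_swap ▸ hy)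
        simp at this
      · have := hM.right_unique hz (Sym2.eq_swap ▸ hy)
        simp at this
  -- Only the chord remains: `mid c` is a hole, `mid (twin c)` is taken, and by parity the hub
  -- enters neither of its chains since the tips do not.
  have h3 : s(cy j (hub c), cy j (hub (c + 2))) ∈ M := by
    obtain ⟨y, hy⟩ := not_mem_holes.1 (hcyc _ d5)
    rcases nbr_hub hk (hM.adj hy) with rfl | rfl | rfl | ⟨p, rfl⟩ | ⟨p, rfl⟩
    · exact absurd hmid (not_mem_holes_right hy)
    · exfalso
      have := hM.right_unique h2 (Sym2.eq_swap ▸ hy)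
      simp only [cy, GVertex.copy.injEq, GadgetVertex.cyc.injEq, true_and] at this
      clear * - this; revert c; decide
    · exact hy
    · exact absurd ⟨p, hy⟩ hhubc
    · exfalso
      rw [← d7] at hy
      obtain ⟨q, hq⟩ := (hchain _).1 ⟨p, hy⟩
      have := hM.right_unique hq (Sym2.eq_swap ▸ h2)
      simp at this
  have h4 : ∀ p : BoxVertex k, ¬ p.IsEnd → s(chi k j c p, chi k j c (off p)) ∈ M := by
    refine off_forced (R := fun p q => s(chi k j c p, chi k j c q) ∈ M)
      (fun p q h => Sym2.eq_swap ▸ h)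
      (fun p q q' h h' => chi_injective j c (hM.right_unique h h')) ?_ ?_
    · intro p hp
      obtain ⟨y, hy⟩ := not_mem_holes.1 (hinn c ⟨p, hp⟩)
      obtain ⟨q, hq, rfl⟩ := nbr_inn (hM.adj hy)
      refine ⟨q, hq, ?_⟩
      rw [chi_of_not_isEnd j c hp]
      exact hy
    · intro p q hp hq h
      rw [chi_of_not_isEnd j c hq] at h
      rcases chi_isEnd j c hp with h' | h' <;> rw [h'] at h
      exacts [hhubc ⟨_, h⟩, htipc ⟨_, h⟩]
  intro e he
  simp only [rarePart, Finset.mem_insert] at he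
  rcases he with rfl | rfl | rfl | he
  · exact hpt
  · exact h1
  · exact h3
  · obtain ⟨p, hp, rfl⟩ := Finset.mem_image.1 he
    exact h4 p (Finset.mem_filter.1 hp).2

open Classical in
/-- The rare states. -/
def rareStates (k : ℕ) (j c : Fin 4) : Finset (State (counterexampleGraph k)) :=
  Finset.univ.filter fun M => Rare M.1 j c

/-- For weights depending only on the hole pattern, rare states have a total weight that is
exponentially small compared to the weight of all states. -/
theorem two_pow_mul_sum_rare_le (hk : 2 ≤ k) {w : State (counterexampleGraph k) → ℝ}
    (hw : ∀ M, 0 < w M) (hh : ∀ M N, holes M.1 = holes N.1 → w M = w N) (j c : Fin 4) :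
    2 ^ k * ∑ M ∈ rareStates k j c, w M ≤ ∑ M, w M := by
  have hsub : ∀ M ∈ rareStates k j c, rarePart k j c ⊆ M.1 := fun M hM =>
    rarePart_subset hk M.2.1 (by simpa [rareStates] using hM)
  have hhc := holes_commonPart (k := k) (by omega) j c
  have hex : ∀ M s, ∃ N : State (counterexampleGraph k), M ∈ rareStates k j c →
      N.1 = M.1 \ rarePart k j c ∪ commonPart k j c s := by
    intro M s
    by_cases hM : M ∈ rareStates k j c
    swap
    -- A default value; `Φ` matters only on rare states.
    · exact ⟨M, fun h => absurd h hM⟩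
    have hD := hsub M hM
    refine ⟨⟨_, M.2.1.switch hD (isMatching_commonPart j c s) (hhc s), ?_⟩, fun _ => rfl⟩
    rw [IsMatching.holes_switch hD (hhc s)]
    exact M.2.2
  choose Φ hΦ' using hex
  have hΦ : ∀ M ∈ rareStates k j c, ∀ s,
      (Φ M s).1 = M.1 \ rarePart k j c ∪ commonPart k j c s := fun M hM s => hΦ' M s hM
  have hwΦ : ∀ M ∈ rareStates k j c, ∀ s, w (Φ M s) = w M := by
    intro M hM s
    refine hh _ _ ?_
    rw [hΦ M hM, IsMatching.holes_switch (hsub M hM) (hhc s)]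
  have hinj' : ∀ M ∈ rareStates k j c, ∀ N ∈ rareStates k j c, ∀ s s', Φ M s = Φ N s' →
      M = N ∧ s = s' := by
    intro M hM N hN s s' h
    have hedge : ∀ L ∈ rareStates k j c, ∀ (s : Fin k → Bool) i,
        s(chi k j c (.a i), chi k j c (on s (.a i))) ∈ (Φ L s).1 := by
      intro L hL s i
      rw [hΦ L hL]
      refine Finset.mem_union_right _ (Finset.mem_insert_of_mem (Finset.mem_insert_of_mem ?_))
      exact Finset.mem_image_of_mem _ (Finset.mem_univ _)
    -- The image determines `s` through its edges at the vertices `a i`; undoing the exchange then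
    -- recovers the rare state.
    have hs : s = s' := by
      refine on_injective fun i => chi_injective j c ?_
      refine (Φ M s).2.1.right_unique (hedge M hM s i) ?_
      rw [h]
      exact hedge N hN s' i
    subst hs
    have h1 := M.2.1.switch_back (hsub M hM) (hhc s)
    have h2 := N.2.1.switch_back (hsub N hN) (hhc s)
    rw [← hΦ M hM, h, hΦ N hN, h2] at h1
    exact ⟨State.ext h1.symm, rfl⟩
  have := card_mul_sum_le (fun M => (hw M).le) hwΦ hinj'
  simpa using this

end RareConfigurations

/-! ### A perfect matching -/

section PerfectMatching

variable {k : ℕ}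

/-- The positions on the twelve-cycle matched by `{a, b}` and the edges at the `mid c`; the values
at `u` and `v` are not used. -/
def chordMatching : Fin 12 → Fin 12 := ![6, 2, 1, 3, 5, 4, 0, 8, 7, 9, 11, 10]

/-- A perfect matching of the twelve-cycle. -/
def cycleMatching : Fin 12 → Fin 12 := ![1, 0, 3, 2, 5, 4, 7, 6, 9, 8, 11, 10]

/-- A perfect matching of the graph, as an involution. -/
def partner : GVertex k → GVertex k
  | .t i => if (i : ℕ) % 2 = 0 then cy i 3 else cy (i - 1) 9
  | .copy j (.cyc m) => if (j : ℕ) % 2 = 0 then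
      (if m = 3 then .t j else if m = 9 then .t (j + 1) else cy j (chordMatching m))
      else cy j (cycleMatching m)
  | .copy j (.inner c p) => inn j c ⟨off p.1, isEnd_off p.2⟩

theorem partner_t (i : Fin 4) : (partner (.t i) : GVertex k) =
    if (i : ℕ) % 2 = 0 then cy i 3 else cy (i - 1) 9 := rfl

theorem partner_cy (j : Fin 4) (m : Fin 12) : (partner (cy j m) : GVertex k) =
    if (j : ℕ) % 2 = 0 then
      (if m = 3 then .t j else if m = 9 then .t (j + 1) else cy j (chordMatching m))
      else cy j (cycleMatching m) := rfl

theorem partner_partner (x : GVertex k) : partner (partner x) = x := by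
  have e : ∀ i : Fin 4, ¬ (i : ℕ) % 2 = 0 → ((i - 1 : Fin 4) : ℕ) % 2 = 0 := by decide
  have e' : ∀ i : Fin 4, (i : ℕ) % 2 = 0 → ¬ ((i + 1 : Fin 4) : ℕ) % 2 = 0 := by decide
  have c1 : ∀ m : Fin 12, m ≠ 3 → m ≠ 9 → chordMatching m ≠ 3 ∧ chordMatching m ≠ 9 ∧
      chordMatching (chordMatching m) = m := by decide
  have c2 : ∀ m : Fin 12, cycleMatching (cycleMatching m) = m := by decide
  rcases x with i | ⟨j, m | ⟨c, p⟩⟩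
  · rw [partner_t]
    split_ifs with h
    · rw [partner_cy, if_pos h, if_pos rfl]
    · rw [partner_cy, if_pos (e i h), if_neg (by decide), if_pos rfl, sub_add_cancel]
  · rw [partner_cy]
    split_ifs with h h3 h9
    · rw [partner_t, if_pos h, h3]
    · rw [partner_t, if_neg (e' j h), h9, add_sub_cancel_right]
    · obtain ⟨h1, h2, h4⟩ := c1 m h3 h9
      rw [partner_cy, if_pos h, if_neg h1, if_neg h2, h4]
    · rw [partner_cy, if_neg h, c2]
  · simp only [partner, inn, off_off]

theorem adj_partner (x : GVertex k) : (counterexampleGraph k).Adj x (partner x) := by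
  have c1 : ∀ m : Fin 12, m ≠ 3 → m ≠ 9 → CycAdj m (chordMatching m) := by decide
  have c2 : ∀ m : Fin 12, CycAdj m (cycleMatching m) := by decide
  rcases x with i | ⟨j, m | ⟨c, p⟩⟩
  · rw [partner_t]
    split_ifs with h <;> simp
  · rw [partner_cy]
    split_ifs with h h3 h9
    · rw [SimpleGraph.adj_comm, h3]; simp
    · rw [SimpleGraph.adj_comm, h9]; simp
    · exact adj_copy_copy.2 ⟨rfl, gadget_adj_cyc (c1 m h3 h9)⟩
    · exact adj_copy_copy.2 ⟨rfl, gadget_adj_cyc (c2 m)⟩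
  · refine adj_copy_copy.2 ⟨rfl, gadget_adj_inner.2 ⟨off p.1, adj_off p.2, ?_⟩⟩
    rw [chainMap_of_not_isEnd c (isEnd_off p.2)]

/-- Irreducibility routes all states through a perfect matching, so one is needed. Even copies have
`u` and `v` matched outwards, odd copies use a perfect matching of the twelve-cycle, and every chain
is matched by `off`. -/
theorem exists_perfect (k : ℕ) : ∃ P : State (counterexampleGraph k), holes P.1 = ∅ := by
  have hM : IsMatching (counterexampleGraph k) (involutionMatching id Finset.univ partner) :=
    isMatching_involutionMatching Function.injective_id (fun p _ => partner_partner p)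
      fun p _ => adj_partner p
  have hh : holes (involutionMatching (id : GVertex k → GVertex k) Finset.univ partner) = ∅ := by
    refine Finset.eq_empty_of_forall_notMem fun v hv => ?_
    rw [mem_holes_involutionMatching fun p _ => Finset.mem_univ _] at hv
    exact hv v (Finset.mem_univ _) rfl
  exact ⟨⟨_, hM, Or.inl (by rw [hh]; rfl)⟩, hh⟩

end PerfectMatching

/-! ### Rotation -/

section Rotation

variable {k : ℕ}

/-- The rotation of the graph. -/
def rot : GVertex k → GVertex k
  | .t i => .t (i + 1)
  | .copy i p => .copy (i + 1) p

theorem rot_injective : Function.Injective (rot : GVertex k → GVertex k) := by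
  rintro (i | ⟨i, p⟩) (j | ⟨j, q⟩) h <;> simp_all [rot]

theorem rot_surjective : Function.Surjective (rot : GVertex k → GVertex k) := by
  rintro (i | ⟨i, p⟩)
  · exact ⟨.t (i - 1), by simp [rot]⟩
  · exact ⟨.copy (i - 1) p, by simp [rot]⟩

theorem adj_rot {x y : GVertex k} (h : (counterexampleGraph k).Adj x y) :
    (counterexampleGraph k).Adj (rot x) (rot y) := by
  have key : ∀ i j (p : GadgetVertex k), (counterexampleGraph k).Adj (.t i) (.copy j p) →
      (counterexampleGraph k).Adj (.t (i + 1)) (.copy (j + 1) p) := by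
    intro i j p h
    rw [adj_t_copy] at h ⊢
    rcases h with ⟨rfl, rfl⟩ | ⟨rfl, rfl⟩ <;> simp
  rcases x with i | ⟨i, p⟩ <;> rcases y with j | ⟨j, q⟩
  · exact absurd h not_adj_t_t
  · exact key i j q h
  · exact (key j i p h.symm).symm
  · rw [adj_copy_copy] at h
    exact adj_copy_copy.2 ⟨by rw [h.1], h.2⟩

theorem isMatching_rot {M : Finset (Sym2 (GVertex k))}
    (hM : IsMatching (counterexampleGraph k) M) :
    IsMatching (counterexampleGraph k) (M.image (Sym2.map rot)) := by
  constructor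
  · intro e he
    obtain ⟨f, hf, rfl⟩ := Finset.mem_image.1 he
    induction f with
    | _ x y => exact adj_rot (hM.adj hf)
  · intro e he e' he' v hv hv'
    obtain ⟨f, hf, rfl⟩ := Finset.mem_image.1 he
    obtain ⟨f', hf', rfl⟩ := Finset.mem_image.1 he'
    obtain ⟨x, hx, rfl⟩ := Sym2.mem_map.1 hv
    obtain ⟨x', hx', h⟩ := Sym2.mem_map.1 hv'
    rw [rot_injective h] at hx'
    rw [hM.2 f hf f' hf' x hx hx']

theorem holes_rot {M : Finset (Sym2 (GVertex k))} (h : holes M = ∅) :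
    holes (M.image (Sym2.map rot)) = ∅ := by
  refine Finset.eq_empty_of_forall_notMem fun v hv => ?_
  obtain ⟨x, rfl⟩ := rot_surjective v
  obtain ⟨y, hy⟩ := not_mem_holes.1 (h ▸ Finset.notMem_empty x : x ∉ holes M)
  exact mem_holes.1 hv _ (Finset.mem_image_of_mem _ hy) (Sym2.mem_map.2 ⟨x, by simp, rfl⟩)

/-- The rotation of a perfect matching (other states are fixed). -/
def rotState (M : State (counterexampleGraph k)) : State (counterexampleGraph k) :=
  if h : holes M.1 = ∅ then
    ⟨M.1.image (Sym2.map rot), isMatching_rot M.2.1, Or.inl (by rw [holes_rot h]; rfl)⟩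
  else M

theorem rotState_val {M : State (counterexampleGraph k)} (h : holes M.1 = ∅) :
    (rotState M).1 = M.1.image (Sym2.map rot) := by
  have : rotState M = ⟨M.1.image (Sym2.map rot), isMatching_rot M.2.1,
    Or.inl (by rw [holes_rot h]; rfl)⟩ := dif_pos h
  rw [this]

theorem flag_perfect {M : Finset (Sym2 (GVertex k))} (h : holes M = ∅) (j : Fin 4) :
    Flag M j ↔ s(.t j, cy j 3) ∈ M :=
  flag_of_eq_empty (by ext r; simp [mem_gadgetHoles, h])

/-- Rotation shifts the flags by one place, and since they alternate, each flag is negated relative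
to the fixed parity pattern. -/
theorem agree_rotState (hk : 1 ≤ k) {M : State (counterexampleGraph k)} (h : holes M.1 = ∅)
    (j : Fin 4) : j ∈ agree (rotState M) ↔ j ∉ agree M := by
  obtain ⟨i, rfl⟩ : ∃ i, j = i + 1 := ⟨j - 1, by simp⟩
  have halt := flag_alternate (j₀ := 0) hk M.2.1 (by rw [h]; simp)
    (by rw [show gadgetHoles M.1 0 = ∅ by ext r; simp [mem_gadgetHoles, h]]; simp) i
  have hrot : Flag (rotState M).1 (i + 1) ↔ Flag M.1 i := by
    rw [rotState_val h, flag_perfect (holes_rot h), flag_perfect h]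
    have hs : s(.t (i + 1), cy (i + 1) 3) = Sym2.map rot s(.t i, (cy i 3 : GVertex k)) := rfl
    rw [hs, Finset.mem_image]
    constructor
    · rintro ⟨e, he, h⟩
      rwa [← Sym2.map.injective rot_injective h]
    · exact fun h => ⟨_, h, rfl⟩
  rw [mem_agree, mem_agree, hrot, halt, not_iff, not_not]

theorem rotState_injOn {M N : State (counterexampleGraph k)} (hM : holes M.1 = ∅)
    (hN : holes N.1 = ∅) (h : rotState M = rotState N) : M = N := by
  have h1 : M.1.image (Sym2.map rot) = N.1.image (Sym2.map rot) := by
    rw [← rotState_val hM, ← rotState_val hN, h]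
  exact State.ext (Finset.image_injective (Sym2.map.injective rot_injective) h1)

end Rotation

/-! ### Weights -/

section Weights

variable {k : ℕ}

open Classical in
/-- The states on one side of the cut. -/
def side (k : ℕ) : Finset (State (counterexampleGraph k)) :=
  Finset.univ.filter fun M => 3 ≤ (agree M).card

theorem mem_side {M : State (counterexampleGraph k)} : M ∈ side k ↔ 3 ≤ (agree M).card := by
  simp [side]

theorem mem_perfectMatchings {M : State (counterexampleGraph k)} :
    M ∈ perfectMatchings (counterexampleGraph k) ↔ holes M.1 = ∅ := by
  simp [perfectMatchings]

/-- A perfect matching agrees with the pattern in all four copies or in none, and rotation exchanges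
these cases. -/
theorem mem_side_rotState (hk : 1 ≤ k) {M : State (counterexampleGraph k)} (h : holes M.1 = ∅) :
    rotState M ∈ side k ↔ M ∉ side k := by
  have hr := agree_rotState hk h
  rw [mem_side, mem_side]
  rcases agree_of_perfect hk h with h' | h'
  · have : agree (rotState M) = ∅ := by ext j; rw [hr, h']; simp
    rw [this, h']; simp
  · have : agree (rotState M) = Finset.univ := by ext j; rw [hr, h']; simp
    rw [this, h']; simp

/-- The cut halves the perfect matchings. -/
theorem card_perfect_side (hk : 1 ≤ k) :
    (perfectMatchings (counterexampleGraph k) ∩ side k).card =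
      (perfectMatchings (counterexampleGraph k) ∩ (side k)ᶜ).card := by
  have hperf : ∀ {M : State (counterexampleGraph k)}, holes M.1 = ∅ →
      holes (rotState M).1 = ∅ := fun h => by rw [rotState_val h]; exact holes_rot h
  apply le_antisymm
  · refine Finset.card_le_card_of_injOn rotState ?_ ?_
    · intro M hM
      rw [Finset.mem_coe, Finset.mem_inter, mem_perfectMatchings] at hM
      rw [Finset.mem_coe, Finset.mem_inter, mem_perfectMatchings, Finset.mem_compl,
        mem_side_rotState hk hM.1]
      exact ⟨hperf hM.1, not_not.2 hM.2⟩
    · intro M hM N hN h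
      rw [Finset.mem_coe, Finset.mem_inter, mem_perfectMatchings] at hM hN
      exact rotState_injOn hM.1 hN.1 h
  · refine Finset.card_le_card_of_injOn rotState ?_ ?_
    · intro M hM
      rw [Finset.mem_coe, Finset.mem_inter, mem_perfectMatchings, Finset.mem_compl] at hM
      rw [Finset.mem_coe, Finset.mem_inter, mem_perfectMatchings, mem_side_rotState hk hM.1]
      exact ⟨hperf hM.1, hM.2⟩
    · intro M hM N hN h
      rw [Finset.mem_coe, Finset.mem_inter, mem_perfectMatchings] at hM hN
      exact rotState_injOn hM.1 hN.1 h

end Weights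

/-! ### The flow through the cut -/

section Flow

/-- If every transition out of `T` starts or ends in `R`, the flow out of `T` is at most the
probability of `R`. -/
theorem flow_le {S : Type*} [Fintype S] [DecidableEq S] {P : Matrix S S ℝ} {π : S → ℝ}
    (hπ : ∀ i, 0 ≤ π i) (hnn : ∀ i j, 0 ≤ P i j) (hrow : ∀ i, ∑ j, P i j = 1)
    (hrev : ∀ i j, π i * P i j = π j * P j i) {T R : Finset S}
    (h : ∀ i ∈ T, ∀ j ∈ Tᶜ, P i j ≠ 0 → i ∈ R ∨ j ∈ R) :
    ∑ i ∈ T, ∑ j ∈ Tᶜ, π i * P i j ≤ ∑ i ∈ R, π i := by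
  have hle : ∀ (A : Finset S) i, ∑ j ∈ A, (if i ∈ R then π i * P i j else 0) ≤
      if i ∈ R then π i else 0 := by
    intro A i
    split_ifs with hi
    · rw [← Finset.mul_sum]
      refine mul_le_of_le_one_right (hπ i) ?_
      rw [← hrow i]
      exact Finset.sum_le_sum_of_subset_of_nonneg (Finset.subset_univ _) fun j _ _ => hnn i j
    · simp
  have hnn' : ∀ i j, 0 ≤ π i * P i j := fun i j => mul_nonneg (hπ i) (hnn i j)
  -- Charge each transition to an endpoint in `R`; if this is the target, reversibility turns it
  -- into flow out of the target. Row sums then bound the charge to each state by its probability.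
  calc ∑ i ∈ T, ∑ j ∈ Tᶜ, π i * P i j
      ≤ ∑ i ∈ T, ∑ j ∈ Tᶜ, ((if i ∈ R then π i * P i j else 0) +
          if j ∈ R then π j * P j i else 0) := by
        refine Finset.sum_le_sum fun i hi => Finset.sum_le_sum fun j hj => ?_
        by_cases hij : P i j = 0
        · rw [hij, mul_zero]
          have := hnn' j i
          refine add_nonneg ?_ ?_ <;> split_ifs <;> simp [this]
        · rcases h i hi j hj hij with hR | hR
          · rw [if_pos hR]
            have := hnn' j i
            refine le_add_of_nonneg_right ?_
            split_ifs <;> simp [this]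
          · rw [if_pos hR, ← hrev i j]
            have := hnn' i j
            refine le_add_of_nonneg_left ?_
            split_ifs <;> simp [this]
    _ = ∑ i ∈ T, ∑ j ∈ Tᶜ, (if i ∈ R then π i * P i j else 0) +
          ∑ j ∈ Tᶜ, ∑ i ∈ T, (if j ∈ R then π j * P j i else 0) := by
        simp only [Finset.sum_add_distrib]
        congr 1
        exact Finset.sum_comm
    _ ≤ ∑ i ∈ T, (if i ∈ R then π i else 0) + ∑ j ∈ Tᶜ, (if j ∈ R then π j else 0) :=
        add_le_add (Finset.sum_le_sum fun i _ => hle _ i) (Finset.sum_le_sum fun j _ => hle _ j)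
    _ = ∑ i ∈ R, π i := by
        rw [Finset.sum_add_sum_compl, Finset.sum_ite_mem, Finset.univ_inter]

/-- A set is halved in probability by `T` if `π` is constant on it and `T` halves its size. -/
theorem sum_inter_eq_half {S : Type*} [Fintype S] [DecidableEq S] {π : S → ℝ} {A T : Finset S}
    {a : ℝ} (ha : ∀ i ∈ A, π i = a) (hc : (A ∩ T).card = (A ∩ Tᶜ).card) :
    ∑ i ∈ A ∩ T, π i = (∑ i ∈ A, π i) / 2 ∧ ∑ i ∈ A ∩ Tᶜ, π i = (∑ i ∈ A, π i) / 2 := by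
  have h0 : ∀ U : Finset S, ∑ i ∈ A ∩ U, π i = (A ∩ U).card * a := fun U => by
    rw [Finset.sum_congr rfl fun i hi => ha i (Finset.mem_inter.1 hi).1]; simp
  have h3 : ∑ i ∈ A, π i = ∑ i ∈ A ∩ T, π i + ∑ i ∈ A ∩ Tᶜ, π i := by
    rw [← Finset.sdiff_eq_inter_compl, Finset.sum_inter_add_sum_sdiff]
  rw [h3, h0, h0, hc]
  constructor <;> ring

/-- If a cut halves a set `A` on which `π` is constant, and every transition through the cut starts
or ends in `R`, then the mixing time is at least `π A / (8 π R)`. -/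
theorem sum_le_mixingTime_mul {S : Type*} [Fintype S] [DecidableEq S] {P : Matrix S S ℝ}
    {π : S → ℝ} (hst : IsStationary P π) (hπ : ∀ i, 0 < π i) (hnn : ∀ i j, 0 ≤ P i j)
    (hrow : ∀ i, ∑ j, P i j = 1) (hrev : ∀ i j, π i * P i j = π j * P j i) {A T R : Finset S}
    {a : ℝ} (ha : ∀ i ∈ A, π i = a) (hc : (A ∩ T).card = (A ∩ Tᶜ).card)
    (hcross : ∀ i ∈ T, ∀ j ∉ T, P i j ≠ 0 → i ∈ R ∨ j ∈ R) {t : ℕ} (ht : mixingTime P π ≤ t) :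
    ∑ i ∈ A, π i ≤ 8 * (t * ∑ i ∈ R, π i) := by
  -- The bottleneck bound is used for whichever of `T` and `Tᶜ` has probability at most `1 / 2`.
  -- Either one contains half of `A`, so `(π A / 2) * (1 / 4) ≤ t * π R`, whence the factor 8.
  have main : ∀ U : Finset S, (∀ i ∈ U, ∀ j ∈ Uᶜ, P i j ≠ 0 → i ∈ R ∨ j ∈ R) →
      ∑ i ∈ A ∩ U, π i = (∑ i ∈ A, π i) / 2 → 1 / 2 ≤ ∑ i ∈ Uᶜ, π i →
      ∑ i ∈ A, π i ≤ 8 * (t * ∑ i ∈ R, π i) := by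
    intro U hU hhalf hU2
    have hflow := flow_le hst.1.1 hnn hrow hrev hU
    have hb := bottleneck hst hnn hrow U hU2 ht
    have hAU : (∑ i ∈ A, π i) / 2 ≤ ∑ i ∈ U, π i := by
      rw [← hhalf]
      exact Finset.sum_le_sum_of_subset_of_nonneg Finset.inter_subset_right
        fun i _ _ => (hπ i).le
    have := mul_le_mul_of_nonneg_left hflow (Nat.cast_nonneg (α := ℝ) t)
    linarith
  obtain ⟨h1, h2⟩ := sum_inter_eq_half ha hc
  have htot := Finset.sum_add_sum_compl T π
  rw [hst.1.2] at htot
  by_cases hhalf : 1 / 2 ≤ ∑ i ∈ Tᶜ, π i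
  · exact main T (fun i hi j hj => hcross i hi j (Finset.mem_compl.1 hj)) h1 hhalf
  · refine main Tᶜ (fun i hi j hj hij => ?_) h2 ?_
    · rw [compl_compl] at hj
      refine (hcross j hj i (Finset.mem_compl.1 hi) fun h => hij ?_).symm
      have := hrev i j
      rw [h, mul_zero] at this
      exact (mul_eq_zero.1 this).resolve_left (hπ i).ne'
    · rw [compl_compl]; linarith

variable {k : ℕ}

theorem sum_biUnion_le {S ι : Type*} [DecidableEq S] {U : Finset ι} {F : ι → Finset S} {w : S → ℝ}
    (hw : ∀ i, 0 ≤ w i) : ∑ i ∈ U.biUnion F, w i ≤ ∑ q ∈ U, ∑ i ∈ F q, w i := by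
  classical
  induction U using Finset.induction_on with
  | empty => simp
  | insert q U hq ih =>
    rw [Finset.biUnion_insert, Finset.sum_insert hq]
    have := Finset.sum_union_inter (s₁ := F q) (s₂ := U.biUnion F) (f := w)
    have := Finset.sum_nonneg fun i (_ : i ∈ F q ∩ U.biUnion F) => hw i
    linarith

/-- All rare states. -/
def allRare (k : ℕ) : Finset (State (counterexampleGraph k)) :=
  Finset.univ.biUnion fun q : Fin 4 × Fin 4 => rareStates k q.1 q.2

theorem mem_allRare {M : State (counterexampleGraph k)} :
    M ∈ allRare k ↔ ∃ j c, Rare M.1 j c := by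
  simp [allRare, rareStates]

theorem rare_of_crossing (hk : 2 ≤ k) {M N : State (counterexampleGraph k)} (h : Step M N)
    (hM : M ∈ side k) (hN : N ∉ side k) : M ∈ allRare k ∨ N ∈ allRare k := by
  by_contra hcon
  push Not at hcon
  rw [mem_allRare, mem_allRare] at hcon
  push Not at hcon
  exact hN (mem_side.2 (no_crossing hk h hcon.1 hcon.2 (mem_side.1 hM)))

/-- A union bound over the four copies and the four chains in each, giving the factor 16. -/
theorem sum_allRare_le (hk : 2 ≤ k) {w : State (counterexampleGraph k) → ℝ}
    (hw : ∀ M, 0 < w M) (hh : ∀ M N, holes M.1 = holes N.1 → w M = w N) :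
    2 ^ k * ∑ M ∈ allRare k, w M ≤ 16 * ∑ M, w M := by
  have h1 : ∑ M ∈ allRare k, w M ≤ ∑ q : Fin 4 × Fin 4, ∑ M ∈ rareStates k q.1 q.2, w M :=
    sum_biUnion_le fun M => (hw M).le
  calc 2 ^ k * ∑ M ∈ allRare k, w M
      ≤ 2 ^ k * ∑ q : Fin 4 × Fin 4, ∑ M ∈ rareStates k q.1 q.2, w M :=
        mul_le_mul_of_nonneg_left h1 (by positivity)
    _ = ∑ q : Fin 4 × Fin 4, 2 ^ k * ∑ M ∈ rareStates k q.1 q.2, w M := Finset.mul_sum _ _ _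
    _ ≤ ∑ _q : Fin 4 × Fin 4, ∑ M, w M :=
        Finset.sum_le_sum fun q _ => two_pow_mul_sum_rare_le hk hw hh q.1 q.2
    _ = 16 * ∑ M, w M := by simp

/-- The mixing time is at least the probability of the perfect matchings times `2 ^ k / 128`. -/
theorem perfect_le_mixing (hk : 2 ≤ k) {w : State (counterexampleGraph k) → ℝ}
    (hw : ∀ M, 0 < w M) (hh : ∀ M N, holes M.1 = holes N.1 → w M = w N)
    {π : State (counterexampleGraph k) → ℝ} (hπ : π = fun M => w M / ∑ N, w N)
    (hst : IsStationary (metropolis (counterexampleGraph k) w) π) {t : ℕ}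
    (ht : mixingTime (metropolis (counterexampleGraph k) w) π ≤ t) :
    2 ^ k * ∑ M ∈ perfectMatchings (counterexampleGraph k), π M ≤ 128 * t := by
  -- The constant is `128 = 8 * 16`: the conductance bound times the number of rare families.
  have key : ∀ p r : ℝ, p ≤ 8 * (t * r) → 2 ^ k * r ≤ 16 → 2 ^ k * p ≤ 128 * t := by
    intro p r h1 h2
    calc 2 ^ k * p ≤ 2 ^ k * (8 * (t * r)) := mul_le_mul_of_nonneg_left h1 (by positivity)
      _ = 8 * t * (2 ^ k * r) := by ring
      _ ≤ 8 * t * 16 := mul_le_mul_of_nonneg_left h2 (by positivity)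
      _ = 128 * t := by ring
  have : Nonempty (GVertex k) := ⟨.t 0⟩
  set P := metropolis (counterexampleGraph k) w with hP
  have hZ : 0 < ∑ N, w N := Finset.sum_pos (fun N _ => hw N)
    ⟨(exists_perfect k).choose, Finset.mem_univ _⟩
  have hπh : ∀ M N, holes M.1 = holes N.1 → π M = π N := fun M N h => by
    rw [hπ]; simp only [hh M N h]
  have hπpos : ∀ M, 0 < π M := fun M => by rw [hπ]; exact div_pos (hw M) hZ
  have hnn := metropolis_nonneg hw
  have hrow := sum_metropolis (w := w)
  have hrev : ∀ M N, π M * P M N = π N * P N M := fun M N => by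
    simp only [hπ]
    rw [div_mul_eq_mul_div, div_mul_eq_mul_div, metropolis_reversible hw]
  have hrare : 2 ^ k * ∑ M ∈ allRare k, π M ≤ 16 := by
    have := sum_allRare_le hk hπpos hπh
    rwa [hst.1.2, mul_one] at this
  obtain ⟨Q, hQ⟩ := exists_perfect k
  have h1 := sum_le_mixingTime_mul hst hπpos hnn hrow hrev (a := π Q) (R := allRare k)
    (fun M hM => hπh M Q ((mem_perfectMatchings.1 hM).trans hQ.symm))
    (card_perfect_side (by omega)) (fun M hM N hN hne => rare_of_crossing hk
      (step_of_metropolis_ne_zero (fun h => hN (h ▸ hM)) hne) hM hN) ht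
  exact key _ _ h1 hrare

end Flow

/-- In logarithms, `7 * log 2 + 0.128 * k + 0.04 ≤ k * log 2`, with ample room from `k = 20` on. The
exponent is doubled because one factor `exp (c * n)` offsets the bound on the perfect matchings and
the other is the bound on the mixing time. -/
theorem exp_mul_le_two_pow {k : ℕ} (hk : 20 ≤ k) :
    128 * Real.exp (2 * (1 / 1000 * ((64 * k + 20 : ℕ) : ℝ))) ≤ 2 ^ k := by
  have h1 := Real.log_two_gt_d9
  have h2 := Real.log_two_lt_d9
  have hk' : (20 : ℝ) ≤ k := by exact_mod_cast hk
  have e1 : (128 : ℝ) = Real.exp (7 * Real.log 2) := by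
    rw [mul_comm, Real.exp_mul, Real.exp_log two_pos]; norm_num
  have e2 : (2 : ℝ) ^ k = Real.exp (k * Real.log 2) := by
    rw [mul_comm, Real.exp_mul, Real.exp_log two_pos, Real.rpow_natCast]
  rw [e1, e2, ← Real.exp_add, Real.exp_le_exp]
  push_cast
  nlinarith

end JSV

end

theorem theorem1 :
    (∀ k : ℕ, 1 ≤ k → Fintype.card (JSV.GVertex k) = 64 * k + 20) ∧
    ∃ c : ℝ, 0 < c ∧ ∃ K : ℕ, 1 ≤ K ∧ ∀ k : ℕ, K ≤ k →
      ∀ P : Matrix (JSV.State (JSV.counterexampleGraph k))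
          (JSV.State (JSV.counterexampleGraph k)) ℝ,
        JSV.IsJSVType (JSV.counterexampleGraph k) P →
        ∃ π : JSV.State (JSV.counterexampleGraph k) → ℝ,
          JSV.IsStationary P π ∧ (∀ π', JSV.IsStationary P π' → π' = π) ∧
          (∑ M ∈ JSV.perfectMatchings (JSV.counterexampleGraph k), π M
              ≤ Real.exp (-(c * (Fintype.card (JSV.GVertex k) : ℝ))) ∨
            ENNReal.ofReal (Real.exp (c * (Fintype.card (JSV.GVertex k) : ℝ)))
              ≤ (JSV.mixingTime P π : ENNReal)) := by
  refine ⟨fun k hk => JSV.card_gVertex hk, 1 / 1000, by norm_num, 20, by norm_num, ?_⟩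
  rintro k hk _ ⟨w, hw, hh, rfl⟩
  have : Nonempty (JSV.GVertex k) := ⟨.t 0⟩
  obtain ⟨Q, hQ⟩ := JSV.exists_perfect k
  obtain ⟨hst, huniq⟩ := JSV.metropolis_stationary hw hQ
  refine ⟨_, hst, huniq, or_iff_not_imp_left.2 fun hperf => ?_⟩
  rw [not_le] at hperf
  -- The chain need not be aperiodic for this argument: an infinite mixing time satisfies the second
  -- alternative trivially.
  rcases eq_or_ne (JSV.mixingTime (JSV.metropolis (JSV.counterexampleGraph k) w)
    fun M => w M / ∑ N, w N) ⊤ with htop | htop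
  · rw [htop]; simp
  · obtain ⟨t, ht⟩ := ENat.ne_top_iff_exists.1 htop
    rw [← ht, ENat.toENNReal_coe, ENNReal.ofReal_le_natCast]
    have h1 := JSV.perfect_le_mixing (by omega) hw hh rfl hst ht.symm.le
    have h2 := JSV.exp_mul_le_two_pow hk
    rw [JSV.card_gVertex (by omega)] at hperf ⊢
    set x : ℝ := 1 / 1000 * ((64 * k + 20 : ℕ) : ℝ) with hx
    have h3 : Real.exp (2 * x) * Real.exp (-x) = Real.exp x := by
      rw [← Real.exp_add]; congr 1; ring
    have h4 := mul_le_mul_of_nonneg_right h2 (Real.exp_pos (-x)).le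
    have h5 := mul_le_mul_of_nonneg_left hperf.le (by positivity : (0 : ℝ) ≤ 2 ^ k)
    rw [mul_assoc, h3] at h4
    linarith
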